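/- For an open neighborhood $U$ of the origin in $\mathbb R^2$, a real-valued smooth function $f$ on $U$ and a real-valued $\varphi\in C_0^\infty(U)$ (smooth, with compact support contained in $U$), let $$Z_f(\varphi)(s)=\int_{\mathbb R^2}|f(x,y)|^s\varphi(x,y)\,dx\,dy\qquad(\operatorname{Re}s>0),$$ let $m_0(f,\varphi)\in[0,\infty]$ be the supremum of all $\rho>0$ such that $Z_f(\varphi)$ can be meromorphically continued to the half-plane $\operatorname{Re}(s)>-\rho$, and let $m_0(f)=m_0(f;U)=\inf\{m_0(f,\varphi):\varphi\in C_0^\infty(U)\}$. A smooth function defined near the origin is called flat if all its derivatives (including the function itself) vanish at the origin. For integers $0\le a<b$ one says that $f$ belongs, on $U$, to - case (C) if $f(x,y)=v(x,y)x^ay^b+h(x,y)$ on $U$, - case (D) if $f(x,y)=v(x,y)x^ay^b+g(x,y)+h(x,y)$ on $U$, where $v,g,h$ are smooth on $U$, $v(0,0)\ne0$, and $g,h$ are non-zero flat functions of the form $g(x,y)=\sum_{j=0}^{b-1}y^jg_j(x)$, $h(x,y)=\sum_{j=0}^{a-1}x^jh_j(y)$ with all $g_j,h_j$ flat at the origin.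 (In particular $f=x^ay^bv+{}$flat, with $a\neq b$; since $h\ne 0$, necessarily $a\ge1$.) **Theorem.** The lower estimates $m_0(f)\ge 1/a$ in case (C) and $m_0(f)\ge 1/b$ in case (D) are optimal, in the sense that they are attained: 1. For all integers $2\le a<b$ there are an open neighborhood $U$ of the origin and a function $f$ on $U$ such that, on every open neighborhood $V\subseteq U$ of the origin, $f$ belongs to case (C) with exponents $a,b$ and $m_0(f;V)=1/a$. 2. For all integers $1\le a<b$ there are an open neighborhood $U$ of the origin and a function $f$ on $U$ such that, on every open neighborhood $V\subseteq U$ of the origin, $f$ belongs to case (D) with exponents $a,b$ and $m_0(f;V)=1/b$. -/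

import Mathlib

open scoped ContDiff ENNReal

noncomputable section

namespace LocalZeta

/-- The test functions `C₀^∞(U)`: real-valued smooth functions with compact support contained
in `U`. -/
def testFunctions (U : Set (ℝ × ℝ)) : Set (ℝ × ℝ → ℝ) :=
  {φ | ContDiff ℝ ∞ φ ∧ HasCompactSupport φ ∧ tsupport φ ⊆ U}

/-- The local zeta function `Z_f(φ)(s) = ∫_{ℝ²} |f(x,y)|^s φ(x,y) dx dy`; only its values for
`Re s > 0`, where the integral converges absolutely, are used below. -/
def zeta (f φ : ℝ × ℝ → ℝ) (s : ℂ) : ℂ :=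
  ∫ z : ℝ × ℝ, ((|f z| : ℝ) : ℂ) ^ s * ((φ z : ℝ) : ℂ)

/-- `Z_f(φ)`, given by the integral for `Re s > 0`, can be meromorphically continued to the
half-plane `Re s > -ρ`. -/
def HasMeromorphicContinuation (f φ : ℝ × ℝ → ℝ) (ρ : ℝ) : Prop :=
  ∃ F : ℂ → ℂ, MeromorphicOn F {s : ℂ | -ρ < s.re} ∧
    ∀ s : ℂ, 0 < s.re → F s = zeta f φ s

/-- `m₀(f, φ) ∈ [0, ∞]`: the supremum of all `ρ > 0` such that `Z_f(φ)` can be meromorphically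
continued to `Re s > -ρ`. -/
def m0Test (f φ : ℝ × ℝ → ℝ) : ℝ≥0∞ :=
  sSup {r : ℝ≥0∞ | ∃ ρ : ℝ, 0 < ρ ∧ HasMeromorphicContinuation f φ ρ ∧ r = ENNReal.ofReal ρ}

/-- `m₀(f) ∈ [0, ∞]` for a function `f` on the neighborhood `U` of the origin: the infimum of
`m₀(f, φ)` over all `φ ∈ C₀^∞(U)`. -/
def m0 (U : Set (ℝ × ℝ)) (f : ℝ × ℝ → ℝ) : ℝ≥0∞ :=
  sInf {r : ℝ≥0∞ | ∃ φ ∈ testFunctions U, r = m0Test f φ}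

/-- `g` is smooth on the neighborhood `U` of the origin and flat at the origin: all its
derivatives, including the zeroth, vanish there. -/
def IsFlatOn {E : Type*} [NormedAddCommGroup E] [NormedSpace ℝ E] (U : Set E) (g : E → ℝ) :
    Prop :=
  ContDiffOn ℝ ∞ g U ∧ ∀ n : ℕ, iteratedFDeriv ℝ n g 0 = 0

/-- `g` is a non-zero flat function on `U` of the form `g(x,y) = ∑_{j<b} y^j g_j(x)` with all
`g_j` flat at the origin. -/
def IsFlatYPoly (b : ℕ) (U : Set (ℝ × ℝ)) (g : ℝ × ℝ → ℝ) : Prop :=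
  IsFlatOn U g ∧ (∃ z ∈ U, g z ≠ 0) ∧
    ∃ gj : ℕ → ℝ → ℝ, (∀ j < b, IsFlatOn (Prod.fst '' U) (gj j)) ∧
      ∀ z ∈ U, g z = ∑ j ∈ Finset.range b, z.2 ^ j * gj j z.1

/-- `h` is a non-zero flat function on `U` of the form `h(x,y) = ∑_{j<a} x^j h_j(y)` with all
`h_j` flat at the origin. -/
def IsFlatXPoly (a : ℕ) (U : Set (ℝ × ℝ)) (h : ℝ × ℝ → ℝ) : Prop :=
  IsFlatOn U h ∧ (∃ z ∈ U, h z ≠ 0) ∧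
    ∃ hj : ℕ → ℝ → ℝ, (∀ j < a, IsFlatOn (Prod.snd '' U) (hj j)) ∧
      ∀ z ∈ U, h z = ∑ j ∈ Finset.range a, z.1 ^ j * hj j z.2

/-- Case (C): `f(x,y) = v(x,y) x^a y^b + h(x,y)` on `U`, with `v` smooth, `v(0,0) ≠ 0`. -/
def CaseC (a b : ℕ) (U : Set (ℝ × ℝ)) (f : ℝ × ℝ → ℝ) : Prop :=
  ∃ v h : ℝ × ℝ → ℝ, ContDiffOn ℝ ∞ v U ∧ v 0 ≠ 0 ∧ IsFlatXPoly a U h ∧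
    ∀ z ∈ U, f z = v z * z.1 ^ a * z.2 ^ b + h z

/-- Case (D): `f(x,y) = v(x,y) x^a y^b + g(x,y) + h(x,y)` on `U`, with `v` smooth,
`v(0,0) ≠ 0`. -/
def CaseD (a b : ℕ) (U : Set (ℝ × ℝ)) (f : ℝ × ℝ → ℝ) : Prop :=
  ∃ v g h : ℝ × ℝ → ℝ, ContDiffOn ℝ ∞ v U ∧ v 0 ≠ 0 ∧ IsFlatYPoly b U g ∧ IsFlatXPoly a U h ∧
    ∀ z ∈ U, f z = v z * z.1 ^ a * z.2 ^ b + g z + h z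

end LocalZeta

end

open scoped ContDiff ENNReal

noncomputable section

namespace LocalZeta

open Set Filter Topology MeasureTheory

/-! The examples live on the whole plane. In both cases one shows that every `Z_f(φ)` continues
meromorphically up to the critical abscissa `-σ` (`σ = 1/a`, resp. `1/b`), and that for a
nonnegative bump `φ` no continuation passes it. The obstruction is growth: near a pole or a regular
point `p = -σ`, a meromorphic function behaves like an integral power of the distance to `p`, or
vanishes identically. A function holomorphic to the right of `-σ` whose modulus at `s = σ(d-1)` is
comparable to `d^α` with `α` not an integer therefore cannot continue across `-σ`
(`no_meromorphic_of_growth`).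

Case (C): `f = x^(a-2) y^b (x² + ψ(y))` with `ψ(y) = exp(-1/y^(2k))`, `k = b - a`. The zeta function
of `x^a y^b` is meromorphic on `Re s > -1` (`exists_meromorphic_monomial`), so only the difference
`zetaDiff` matters. It is holomorphic for `Re s > -1/a`, because the flatness of `ψ` absorbs the
singularity in `y`. At `s = (d-1)/a` the difference lives where `x² ≲ ψ(y)`; integrating `|x|^(d-1)`
there gives `ψ(y)^(d/2)/d`, which is negligible for `|y|` well below `η = d^(1/(2k))` and of order
`1/d` for `|y| ≥ η`. As `bs + 1 < 0` for small `d`, the integral of `|y|^(bs)` beyond `η` has order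
`η^(bs+1)`. Altogether the size is `d^(-1-1/(2a))` (`zetaDiff_growth`), with exponent in `(-2,-1)`.

Case (D): `f = x^(a-1) (x + e(y)) y^(b-2) (y² + exp(-1/x²))`, where `e` is flat and vanishes for `y
≤ 0`. Here `|f|^σ` is locally integrable for `-1/b < σ < 0`, so the zeta function itself is
holomorphic for `Re s > -1/b`. At `s = (d-1)/b` the `y`-integral is of order `(1 -
exp(-d/(2x²)))/d`, that is `d⁻¹ min(1, d/x²)`; integrating against `|x|^(as)` gives `d⁻¹ η^(as+1)`
with `η = √d`, of order `d^(-1/2-a/(2b))` (`zeta_fD_growth`). Since `a < b`, this exponent lies in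
`(-1,0)`. -/

/-- The flat even function `exp (-1 / t ^ (2 k))`. -/
def psi (k : ℕ) (t : ℝ) : ℝ := expNegInvGlue (t ^ (2 * k))

/-- All derivatives of `g` at `x` vanish. -/
def FlatAt {E : Type*} [NormedAddCommGroup E] [NormedSpace ℝ E] (g : E → ℝ) (x : E) : Prop :=
  ∀ n : ℕ, iteratedFDeriv ℝ n g x = 0

/-! ### Flatness under composition and multiplication -/

section Flat

variable {E F : Type*} [NormedAddCommGroup E] [NormedSpace ℝ E] [NormedAddCommGroup F]
  [NormedSpace ℝ F]

/-- The quantitative Faà di Bruno estimate is linear in the bound `C` for the derivatives of the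
outer function, and flatness allows `C = 0`. -/
lemma FlatAt.comp {g : F → ℝ} {f : E → F} {x : E} (h : FlatAt g (f x)) (hg : ContDiff ℝ ∞ g)
    (hf : ContDiff ℝ ∞ f) : FlatAt (fun y => g (f y)) x := by
  intro n
  -- The summand `1` makes `D ≥ 1`, so that `D ≤ D ^ i` for `i ≥ 1`.
  set D : ℝ := 1 + ∑ i ∈ Finset.range (n + 1), ‖iteratedFDeriv ℝ i f x‖ with hD
  have hD1 : 1 ≤ D := by
    have : 0 ≤ ∑ i ∈ Finset.range (n + 1), ‖iteratedFDeriv ℝ i f x‖ := by positivity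
    linarith
  have key := norm_iteratedFDeriv_comp_le (n := n) (N := ∞) hg hf (by exact_mod_cast le_top) x
    (C := 0) (D := D) (fun i _ => by rw [h i]; simp) (fun i hi1 hin => by
      have h1 : ‖iteratedFDeriv ℝ i f x‖ ≤ D := by
        have := Finset.single_le_sum (f := fun i => ‖iteratedFDeriv ℝ i f x‖)
          (fun i _ => norm_nonneg _) (Finset.mem_range.2 (Nat.lt_succ_of_le hin))
        linarith
      exact h1.trans (le_self_pow₀ hD1 (by omega)))
  have : ‖iteratedFDeriv ℝ n (g ∘ f) x‖ ≤ 0 := by simpa using key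
  simpa [Function.comp_def] using this

lemma FlatAt.mul_left {g f : E → ℝ} {x : E} (h : FlatAt g x) (hg : ContDiff ℝ ∞ g)
    (hf : ContDiff ℝ ∞ f) : FlatAt (fun y => f y * g y) x := by
  intro n
  have key := norm_iteratedFDeriv_mul_le (n := n) (N := ∞) hf hg x (by exact_mod_cast le_top)
  have h0 : ∑ i ∈ Finset.range (n + 1), (n.choose i : ℝ) * ‖iteratedFDeriv ℝ i f x‖ *
      ‖iteratedFDeriv ℝ (n - i) g x‖ = 0 :=
    Finset.sum_eq_zero fun i _ => by rw [h]; simp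
  rw [h0] at key
  exact norm_le_zero_iff.1 key

lemma FlatAt.zero : FlatAt (fun _ : E => (0 : ℝ)) 0 := by
  intro n
  exact congrFun (iteratedFDeriv_fun_zero (𝕜 := ℝ)) 0

end Flat

/-! ### Flat building blocks and the flat remainders of the two cases -/

lemma contDiff_expNegInvGlue : ContDiff ℝ ∞ expNegInvGlue := expNegInvGlue.contDiff (n := ⊤)

/-- The function is identically zero on the negative axis, and its derivatives are continuous. -/
lemma flatAt_expNegInvGlue : FlatAt expNegInvGlue 0 := by
  intro n
  have hc : Continuous (iteratedFDeriv ℝ n expNegInvGlue) :=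
    contDiff_expNegInvGlue.continuous_iteratedFDeriv (by exact_mod_cast le_top)
  have hz : ∀ x ∈ Iio (0 : ℝ), iteratedFDeriv ℝ n expNegInvGlue x = 0 := by
    intro x hx
    have he : expNegInvGlue =ᶠ[𝓝 x] fun _ => (0 : ℝ) := by
      filter_upwards [isOpen_Iio.mem_nhds hx] with y hy
      exact expNegInvGlue.zero_of_nonpos (le_of_lt hy)
    rw [(he.iteratedFDeriv (𝕜 := ℝ) n).eq_of_nhds]
    exact congrFun (iteratedFDeriv_fun_zero (𝕜 := ℝ)) x
  have hcl : IsClosed {x | iteratedFDeriv ℝ n expNegInvGlue x = 0} := isClosed_eq hc continuous_const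
  have : (0 : ℝ) ∈ closure (Iio (0 : ℝ)) := by rw [closure_Iio]; simp
  exact hcl.closure_subset_iff.2 hz this

/-- Division of a flat function by a power stays smooth; this puts the cross term of `fD` into the
unit factor `v`. -/
lemma contDiff_inv_pow_mul_expNegInvGlue (m : ℕ) :
    ContDiff ℝ ∞ (fun x : ℝ => (x⁻¹) ^ m * expNegInvGlue x) := by
  have := expNegInvGlue.contDiff_polynomial_eval_inv_mul (n := ⊤) (Polynomial.X ^ m : Polynomial ℝ)
  simpa using this

lemma contDiff_psi (k : ℕ) : ContDiff ℝ ∞ (psi k) :=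
  contDiff_expNegInvGlue.comp (contDiff_id.pow _)

lemma flatAt_psi {k : ℕ} (hk : k ≠ 0) : FlatAt (psi k) 0 := by
  refine FlatAt.comp (g := expNegInvGlue) (f := fun t : ℝ => t ^ (2 * k)) ?_
    contDiff_expNegInvGlue (contDiff_id.pow _)
  simpa [hk] using flatAt_expNegInvGlue

lemma psi_nonneg (k : ℕ) (t : ℝ) : 0 ≤ psi k t := expNegInvGlue.nonneg _

lemma psi_of_ne_zero (k : ℕ) {t : ℝ} (ht : t ≠ 0) : psi k t = Real.exp (-(t ^ (2 * k))⁻¹) := by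
  have : 0 < t ^ (2 * k) := by rw [pow_mul]; positivity
  simp [psi, expNegInvGlue, not_le.2 this]

lemma psi_pos (k : ℕ) {t : ℝ} (ht : t ≠ 0) : 0 < psi k t := by
  rw [psi_of_ne_zero k ht]; positivity

lemma psi_abs (k : ℕ) (t : ℝ) : psi k |t| = psi k t := by
  simp [psi, pow_mul]

lemma psi_mono (k : ℕ) {s t : ℝ} (h : |s| ≤ |t|) : psi k s ≤ psi k t := by
  rw [← psi_abs k s, ← psi_abs k t]
  exact expNegInvGlue.monotone (pow_le_pow_left₀ (abs_nonneg _) h _)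

lemma continuous_psi (k : ℕ) : Continuous (psi k) := (contDiff_psi k).continuous

lemma isFlatOn_of_flatAt {E : Type*} [NormedAddCommGroup E] [NormedSpace ℝ E] {U : Set E}
    {g : E → ℝ} (hg : ContDiff ℝ ∞ g) (h : FlatAt g 0) : IsFlatOn U g := ⟨hg.contDiffOn, h⟩

lemma exists_pos_mem {V : Set (ℝ × ℝ)} (hV : IsOpen V) (h0 : (0 : ℝ × ℝ) ∈ V) :
    ∃ t : ℝ, 0 < t ∧ (t, t) ∈ V := by
  have hc : Continuous (fun t : ℝ => (t, t)) := by fun_prop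
  have : ∀ᶠ t in 𝓝[>] (0 : ℝ), (t, t) ∈ V :=
    nhdsWithin_le_nhds (hc.continuousAt.preimage_mem_nhds (hV.mem_nhds h0))
  obtain ⟨t, ht, hp⟩ := (this.and self_mem_nhdsWithin).exists
  exact ⟨t, hp, ht⟩

lemma isFlatXPoly_single {a j : ℕ} (hj : j < a) {V : Set (ℝ × ℝ)} (hV : IsOpen V)
    (h0 : (0 : ℝ × ℝ) ∈ V) {u : ℝ → ℝ} (hu : ContDiff ℝ ∞ u) (hf : FlatAt u 0)
    (hpos : ∀ t, 0 < t → u t ≠ 0) :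
    IsFlatXPoly a V (fun z => z.1 ^ j * u z.2) := by
  refine ⟨isFlatOn_of_flatAt (by fun_prop) ?_, ?_, fun i => if i = j then u else fun _ => 0, ?_, ?_⟩
  · exact FlatAt.mul_left (f := fun z : ℝ × ℝ => z.1 ^ j) (g := fun z : ℝ × ℝ => u z.2)
      (FlatAt.comp (g := u) (f := Prod.snd) (by simpa using hf) hu contDiff_snd)
      (by fun_prop) (by fun_prop)
  · obtain ⟨t, ht, htV⟩ := exists_pos_mem hV h0
    exact ⟨(t, t), htV, mul_ne_zero (pow_ne_zero _ ht.ne') (hpos t ht)⟩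
  · intro i _
    by_cases hij : i = j
    · simpa [hij] using isFlatOn_of_flatAt hu hf
    · simpa [hij] using isFlatOn_of_flatAt contDiff_const FlatAt.zero
  · intro z _
    rw [Finset.sum_eq_single j]
    · simp
    · intro i _ hij; simp [hij]
    · intro h; exact absurd (Finset.mem_range.2 hj) h

lemma isFlatYPoly_single {b j : ℕ} (hj : j < b) {V : Set (ℝ × ℝ)} (hV : IsOpen V)
    (h0 : (0 : ℝ × ℝ) ∈ V) {u : ℝ → ℝ} (hu : ContDiff ℝ ∞ u) (hf : FlatAt u 0)
    (hpos : ∀ t, 0 < t → u t ≠ 0) :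
    IsFlatYPoly b V (fun z => z.2 ^ j * u z.1) := by
  refine ⟨isFlatOn_of_flatAt (by fun_prop) ?_, ?_, fun i => if i = j then u else fun _ => 0, ?_, ?_⟩
  · exact FlatAt.mul_left (f := fun z : ℝ × ℝ => z.2 ^ j) (g := fun z : ℝ × ℝ => u z.1)
      (FlatAt.comp (g := u) (f := Prod.fst) (by simpa using hf) hu contDiff_fst)
      (by fun_prop) (by fun_prop)
  · obtain ⟨t, ht, htV⟩ := exists_pos_mem hV h0
    exact ⟨(t, t), htV, mul_ne_zero (pow_ne_zero _ ht.ne') (hpos t ht)⟩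
  · intro i _
    by_cases hij : i = j
    · simpa [hij] using isFlatOn_of_flatAt hu hf
    · simpa [hij] using isFlatOn_of_flatAt contDiff_const FlatAt.zero
  · intro z _
    rw [Finset.sum_eq_single j]
    · simp
    · intro i _ hij; simp [hij]
    · intro h; exact absurd (Finset.mem_range.2 hj) h

/-! ### The examples and their membership in cases (C) and (D) -/

/-- The example for case (C). -/
def fC (a b : ℕ) (z : ℝ × ℝ) : ℝ := z.1 ^ (a - 2) * z.2 ^ b * (z.1 ^ 2 + psi (b - a) z.2)

/-- The example for case (D). -/
def fD (a b : ℕ) (z : ℝ × ℝ) : ℝ :=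
  z.1 ^ (a - 1) * (z.1 + expNegInvGlue z.2) * (z.2 ^ (b - 2) * (z.2 ^ 2 + psi 1 z.1))

lemma caseC_fC {a b : ℕ} (ha : 2 ≤ a) (hab : a < b) {V : Set (ℝ × ℝ)} (hV : IsOpen V)
    (h0 : (0 : ℝ × ℝ) ∈ V) : CaseC a b V (fC a b) := by
  have hk : b - a ≠ 0 := by omega
  have hs := contDiff_psi (b - a)
  refine ⟨fun _ => 1, fun z => z.1 ^ (a - 2) * (z.2 ^ b * psi (b - a) z.2), contDiffOn_const,
    one_ne_zero, ?_, ?_⟩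
  · exact isFlatXPoly_single (u := fun y => y ^ b * psi (b - a) y) (by omega) hV h0 (by fun_prop)
      (FlatAt.mul_left (f := fun y : ℝ => y ^ b) (flatAt_psi hk) hs (by fun_prop))
      (fun t ht => mul_ne_zero (pow_ne_zero _ ht.ne') (psi_pos _ ht.ne').ne')
  · intro z _
    have : z.1 ^ a = z.1 ^ (a - 2) * z.1 ^ 2 := by rw [← pow_add]; congr 1; omega
    simp only [fC, this]; ring

/-- Expanding `fD` gives `x^a y^b`, one flat term polynomial in `y`, one polynomial in `x`, and a
cross term. The cross term is `x^a y^b` times `(ψ(x)/x)(e(y)/y²)`, a smooth function vanishing at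
the origin, so it is absorbed in `v`. -/
lemma caseD_fD {a b : ℕ} (ha : 1 ≤ a) (hab : a < b) {V : Set (ℝ × ℝ)} (hV : IsOpen V)
    (h0 : (0 : ℝ × ℝ) ∈ V) : CaseD a b V (fD a b) := by
  have hs := contDiff_psi 1
  have he := contDiff_expNegInvGlue
  have h2 := contDiff_inv_pow_mul_expNegInvGlue 2
  -- This is `ψ(x)/x`, written as `x · (ψ(x)/x²)` so that it is a function of `x²` up to the factor
  -- `x`.
  have h1 : ContDiff ℝ ∞ (fun x : ℝ => x * (((x ^ 2)⁻¹) ^ 1 * expNegInvGlue (x ^ 2))) :=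
    contDiff_id.mul ((contDiff_inv_pow_mul_expNegInvGlue 1).comp (contDiff_id.pow 2))
  refine ⟨fun z => 1 + (z.1 * (((z.1 ^ 2)⁻¹) ^ 1 * expNegInvGlue (z.1 ^ 2))) *
      ((z.2⁻¹) ^ 2 * expNegInvGlue z.2),
    fun z => z.2 ^ (b - 2) * (z.1 ^ a * psi 1 z.1),
    fun z => z.1 ^ (a - 1) * (z.2 ^ b * expNegInvGlue z.2), ?_, by simp, ?_, ?_, ?_⟩
  · exact (contDiff_const.add ((h1.comp contDiff_fst).mul (h2.comp contDiff_snd))).contDiffOn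
  · exact isFlatYPoly_single (u := fun y => y ^ a * psi 1 y) (by omega) hV h0 (by fun_prop)
      (FlatAt.mul_left (f := fun y : ℝ => y ^ a) (flatAt_psi one_ne_zero) hs (by fun_prop))
      (fun t ht => mul_ne_zero (pow_ne_zero _ ht.ne') (psi_pos _ ht.ne').ne')
  · exact isFlatXPoly_single (u := fun y => y ^ b * expNegInvGlue y) (by omega) hV h0 (by fun_prop)
      (FlatAt.mul_left (f := fun y : ℝ => y ^ b) flatAt_expNegInvGlue he (by fun_prop))
      (fun t ht => mul_ne_zero (pow_ne_zero _ ht.ne') (expNegInvGlue.pos_of_pos ht).ne')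
  · rintro ⟨x, y⟩ _
    obtain ⟨a, rfl⟩ : ∃ k, a = k + 1 := ⟨a - 1, by omega⟩
    obtain ⟨b, rfl⟩ : ∃ k, b = k + 2 := ⟨b - 2, by omega⟩
    simp only [fD, Nat.add_sub_cancel, psi, mul_one, pow_one]
    -- On the axes `0⁻¹ = 0` makes the correction to `v` vanish, in agreement with flatness; off
    -- them the inverses cancel.
    rcases eq_or_ne x 0 with rfl | hx
    · rcases eq_or_ne y 0 with rfl | hy
      · simp
      · simp; ring
    · rcases eq_or_ne y 0 with rfl | hy
      · simp
        ring
      · field_simp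
        ring

/-! ### Uniqueness of meromorphic continuation and the growth obstruction -/

/-- The open vertical strip `l < Re s < u`. -/
def strip (l u : ℝ) : Set ℂ := {s | l < s.re ∧ s.re < u}

lemma isOpen_strip (l u : ℝ) : IsOpen (strip l u) :=
  (isOpen_lt continuous_const Complex.continuous_re).inter
    (isOpen_lt Complex.continuous_re continuous_const)

lemma isPreconnected_strip (l u : ℝ) : IsPreconnected (strip l u) := by
  have : Convex ℝ (strip l u) :=
    (convex_halfSpace_re_gt l).inter (convex_halfSpace_re_lt u)
  exact this.isPreconnected

/-- If `F` and `G` are meromorphic on a preconnected set `W` and agree near a point of `W`, then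
they agree on a punctured neighborhood of every point of `W`. -/
lemma eventuallyEq_nhdsNE_of_meromorphicOn {F G : ℂ → ℂ} {W : Set ℂ} (hW : IsPreconnected W)
    (hF : MeromorphicOn F W) (hG : MeromorphicOn G W) {p : ℂ} (hp : p ∈ W)
    (h : F =ᶠ[𝓝[≠] p] G) {w : ℂ} (hw : w ∈ W) : F =ᶠ[𝓝[≠] w] G := by
  have hFG : MeromorphicOn (F - G) W := hF.sub hG
  have htop : meromorphicOrderAt (F - G) p = ⊤ := by
    rw [meromorphicOrderAt_eq_top_iff]
    filter_upwards [h] with z hz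
    simp [hz]
  -- Infinite order at one point spreads over a preconnected set.
  have hwt : meromorphicOrderAt (F - G) w = ⊤ := by
    by_contra hne
    exact hFG.meromorphicOrderAt_ne_top_of_isPreconnected hW hw hp hne htop
  rw [meromorphicOrderAt_eq_top_iff] at hwt
  filter_upwards [hwt] with z hz
  exact sub_eq_zero.1 hz

lemma eq_of_eventuallyEq_nhdsNE {F G : ℂ → ℂ} {z : ℂ} (hF : ContinuousAt F z)
    (hG : ContinuousAt G z) (h : F =ᶠ[𝓝[≠] z] G) : F z = G z := by
  have h1 : Tendsto F (𝓝[≠] z) (𝓝 (F z)) := hF.tendsto.mono_left nhdsWithin_le_nhds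
  have h2 : Tendsto G (𝓝[≠] z) (𝓝 (G z)) := hG.tendsto.mono_left nhdsWithin_le_nhds
  exact tendsto_nhds_unique (h1.congr' h) h2

/-- The power `d ^ β` is not pinched between positive constants as `d → 0+` if `β ≠ 0`. -/
lemma rpow_not_pinched {β c C : ℝ} (hβ : β ≠ 0) (hc : 0 < c)
    (h : ∀ᶠ d : ℝ in 𝓝[>] 0, c ≤ d ^ β ∧ d ^ β ≤ C) : False := by
  rcases lt_or_gt_of_ne hβ with hβ | hβ
  · have ht := tendsto_rpow_neg_nhdsGT_zero hβ
    obtain ⟨d, hd, hd2⟩ := (h.and (ht.eventually_gt_atTop C)).exists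
    linarith [hd.2]
  · have ht : Tendsto (fun d : ℝ => d ^ β) (𝓝[>] 0) (𝓝 0) := by
      have := (Real.continuousAt_rpow_const 0 β (Or.inr hβ.le)).tendsto
      rw [Real.zero_rpow hβ.ne'] at this
      exact this.mono_left nhdsWithin_le_nhds
    obtain ⟨d, hd, hd2⟩ := (h.and (ht.eventually (gt_mem_nhds hc))).exists
    linarith [hd.1]

/-- A function with growth of non-integral order along the real axis at the boundary point `-σ`
of its strip of holomorphy has no meromorphic continuation across this point. -/
lemma no_meromorphic_of_growth {σ ρ α c C : ℝ} (hσ : 0 < σ) (hρ : σ < ρ) {F G : ℂ → ℂ}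
    (hF : MeromorphicOn F (strip (-ρ) 1)) (hG : DifferentiableOn ℂ G (strip (-σ) 1))
    (hFG : ∀ s ∈ strip 0 1, F s = G s) (hc : 0 < c) (hα : ∀ n : ℤ, α ≠ n)
    (hb : ∀ᶠ d : ℝ in 𝓝[>] 0, c * d ^ α ≤ ‖G ((σ * (d - 1) : ℝ) : ℂ)‖ ∧
      ‖G ((σ * (d - 1) : ℝ) : ℂ)‖ ≤ C * d ^ α) : False := by
  have hFW : MeromorphicOn F (strip (-σ) 1) := hF.mono_set fun s hs => ⟨by linarith [hs.1], hs.2⟩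
  have hGA : AnalyticOnNhd ℂ G (strip (-σ) 1) := hG.analyticOnNhd (isOpen_strip _ _)
  have hhalf : ((1 / 2 : ℝ) : ℂ) ∈ strip 0 1 := by
    constructor <;> simp only [Complex.ofReal_re] <;> norm_num
  have hhalf' : ((1 / 2 : ℝ) : ℂ) ∈ strip (-σ) 1 := ⟨by linarith [hhalf.1], hhalf.2⟩
  have hloc : ∀ w ∈ strip (-σ) 1, F =ᶠ[𝓝[≠] w] G := fun w hw =>
    eventuallyEq_nhdsNE_of_meromorphicOn (isPreconnected_strip _ _) hFW
      (fun s hs => (hGA s hs).meromorphicAt) hhalf'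
      (by filter_upwards [mem_nhdsWithin_of_mem_nhds ((isOpen_strip 0 1).mem_nhds hhalf)]
            with z hz using hFG z hz) hw
  set p : ℂ := ((-σ : ℝ) : ℂ) with hp
  have hFp : MeromorphicAt F p := hF p ⟨by simp [hp, hρ], by simp [hp]; linarith⟩
  have hz : Tendsto (fun d : ℝ => ((σ * (d - 1) : ℝ) : ℂ)) (𝓝[>] 0) (𝓝[≠] p) := by
    refine tendsto_nhdsWithin_iff.2 ⟨?_, ?_⟩
    · have : Continuous (fun d : ℝ => ((σ * (d - 1) : ℝ) : ℂ)) := by fun_prop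
      have h := this.tendsto 0
      simp only [zero_sub, mul_neg, mul_one] at h
      exact h.mono_left nhdsWithin_le_nhds
    · filter_upwards [self_mem_nhdsWithin] with d (hd : 0 < d)
      rw [mem_compl_iff, mem_singleton_iff, hp, Complex.ofReal_inj]
      have := mul_pos hσ hd
      intro h; nlinarith
  have hzW : ∀ᶠ d : ℝ in 𝓝[>] 0, ((σ * (d - 1) : ℝ) : ℂ) ∈ strip (-σ) 1 := by
    filter_upwards [Ioo_mem_nhdsGT (show (0 : ℝ) < 1 by norm_num)] with d hd
    have := mul_pos hσ hd.1
    have := mul_pos hσ (sub_pos.2 hd.2)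
    constructor <;> simp only [Complex.ofReal_re] <;> nlinarith
  -- transfer of a local description of `F` at `p` to `G`
  have key : ∀ H : ℂ → ℂ, (∀ᶠ z in 𝓝[≠] p, F z = H z) → (∀ᶠ z in 𝓝[≠] p, ContinuousAt H z) →
      ∀ᶠ d : ℝ in 𝓝[>] 0, G ((σ * (d - 1) : ℝ) : ℂ) = H ((σ * (d - 1) : ℝ) : ℂ) := by
    intro H hFH hHc
    have hFH' : ∀ᶠ z in 𝓝[≠] p, F =ᶠ[𝓝[≠] z] H := by
      have := eventually_eventually_nhdsWithin.2 hFH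
      filter_upwards [this, self_mem_nhdsWithin] with z hz hzp
      rw [(isOpen_compl_singleton).nhdsWithin_eq hzp] at hz
      exact hz.filter_mono nhdsWithin_le_nhds
    filter_upwards [hz.eventually hFH', hz.eventually hHc, hzW] with d h1 h2 h3
    refine eq_of_eventuallyEq_nhdsNE (hGA _ h3).continuousAt h2 ?_
    exact (hloc _ h3).symm.trans h1
  have hdpos : ∀ᶠ d : ℝ in 𝓝[>] 0, 0 < d := self_mem_nhdsWithin
  -- Infinite order would make `G` vanish along the axis near `p`, against the lower bound. With
  -- finite order `n`, `F` is `(z - p) ^ n` times a function analytic and nonzero at `p`; since `z -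
  -- p = σ d`, the ratio `d ^ (α - n)` would stay between positive constants.
  by_cases htop : meromorphicOrderAt F p = ⊤
  · rw [meromorphicOrderAt_eq_top_iff] at htop
    obtain ⟨d, hd, hd0, hd1⟩ := ((key (fun _ => 0) htop
      (Eventually.of_forall fun z => continuousAt_const)).and (hdpos.and hb)).exists
    rw [hd, norm_zero] at hd1
    have : 0 < c * d ^ α := by positivity
    linarith [hd1.1]
  · obtain ⟨g, hg, hg0, hgF⟩ := (meromorphicOrderAt_ne_top_iff hFp).1 htop
    set n := (meromorphicOrderAt F p).untop₀ with hn
    have hcont : ∀ᶠ z in 𝓝[≠] p, ContinuousAt (fun z => (z - p) ^ n • g z) z := by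
      filter_upwards [self_mem_nhdsWithin, hg.eventually_analyticAt.filter_mono nhdsWithin_le_nhds]
        with z hz hgz
      have : z - p ≠ 0 := sub_ne_zero.2 hz
      exact ((continuousAt_id.sub continuousAt_const).zpow₀ n (Or.inl this)).smul hgz.continuousAt
    have h1 := key _ hgF hcont
    have hgl : Tendsto (fun d : ℝ => ‖g ((σ * (d - 1) : ℝ) : ℂ)‖) (𝓝[>] 0) (𝓝 ‖g p‖) :=
      (hg.continuousAt.norm.tendsto.comp ((tendsto_nhdsWithin_iff.1 hz).1))
    have hgp : 0 < ‖g p‖ := norm_pos_iff.2 hg0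
    have h2 := hgl.eventually (lt_mem_nhds (show ‖g p‖ / 2 < ‖g p‖ by linarith))
    have h3 := hgl.eventually (gt_mem_nhds (show ‖g p‖ < 2 * ‖g p‖ by linarith))
    have hC : 0 < C := by
      obtain ⟨d, hd0, hd1⟩ := (hdpos.and hb).exists
      have h4 : 0 < c * d ^ α := by positivity
      have h5 : 0 < d ^ α := by positivity
      by_contra hC
      nlinarith [hd1.1, hd1.2]
    have hσn : 0 < σ ^ n := zpow_pos hσ n
    refine rpow_not_pinched (β := α - n) (sub_ne_zero.2 (hα n))
      (c := σ ^ n * (‖g p‖ / 2) / C) (C := σ ^ n * (2 * ‖g p‖) / c) (by positivity) ?_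
    filter_upwards [h1, h2, h3, hb, hdpos] with d e1 e2 e3 e4 hd
    have hdn : 0 < d ^ n := zpow_pos hd n
    have hnorm : ‖G ((σ * (d - 1) : ℝ) : ℂ)‖ = σ ^ n * d ^ n * ‖g ((σ * (d - 1) : ℝ) : ℂ)‖ := by
      rw [e1, norm_smul, norm_zpow, hp, ← Complex.ofReal_sub, Complex.norm_real,
        show σ * (d - 1) - -σ = σ * d by ring, Real.norm_of_nonneg (by positivity), mul_zpow]
    have hdα : d ^ α = d ^ (α - n) * d ^ n := by
      rw [← Real.rpow_intCast d n, ← Real.rpow_add hd]; congr 1; ring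
    rw [hnorm, hdα] at e4
    obtain ⟨e4, e5⟩ := e4
    have e4' : c * d ^ (α - n) ≤ σ ^ n * ‖g ((σ * (d - 1) : ℝ) : ℂ)‖ := by
      refine le_of_mul_le_mul_right ?_ hdn
      linarith
    have e5' : σ ^ n * ‖g ((σ * (d - 1) : ℝ) : ℂ)‖ ≤ C * d ^ (α - n) := by
      refine le_of_mul_le_mul_right ?_ hdn
      linarith
    constructor
    · rw [div_le_iff₀ hC]
      have := mul_le_mul_of_nonneg_left e2.le hσn.le
      linarith
    · rw [le_div_iff₀ hc]
      have := mul_le_mul_of_nonneg_left e3.le hσn.le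
      linarith

/-! ### Holomorphic dependence of integrals on a parameter -/

/-- Holomorphy of parametric integrals: it is enough that the integrand is locally dominated. -/
lemma differentiableOn_integral_of_dominated {X : Type*} [MeasurableSpace X] {μ : Measure X}
    {W : Set ℂ} (hW : IsOpen W) {I : ℂ → X → ℂ}
    (hm : ∀ s ∈ W, AEStronglyMeasurable (I s) μ)
    (hd : ∀ᵐ z ∂μ, DifferentiableOn ℂ (fun s => I s z) W)
    (hb : ∀ s₀ ∈ W, ∃ r > 0, ∃ g : X → ℝ, Integrable g μ ∧
      ∀ᵐ z ∂μ, ∀ s ∈ Metric.ball s₀ r, s ∈ W → ‖I s z‖ ≤ g z) :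
    DifferentiableOn ℂ (fun s => ∫ z, I s z ∂μ) W := by
  intro s₀ hs₀
  obtain ⟨r₁, hr₁, g, hg, hbd⟩ := hb s₀ hs₀
  obtain ⟨r₂, hr₂, hball⟩ := Metric.isOpen_iff.1 hW s₀ hs₀
  -- Halving the radius keeps circles of radius `r` centred in the `r`-ball inside the region where
  -- the domination holds.
  set r := min r₁ r₂ / 2 with hr
  have hr0 : 0 < r := by positivity
  have hr1 : 2 * r ≤ r₁ := by rw [hr]; linarith [min_le_left r₁ r₂]
  have hr2 : 2 * r ≤ r₂ := by rw [hr]; linarith [min_le_right r₁ r₂]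
  have hsub : Metric.ball s₀ (2 * r) ⊆ W := (Metric.ball_subset_ball hr2).trans hball
  have hs₀' : s₀ ∈ Metric.ball s₀ (2 * r) := Metric.mem_ball_self (by positivity)
  have hmeas : ∀ᶠ s in 𝓝 s₀, AEStronglyMeasurable (I s) μ := by
    filter_upwards [hW.mem_nhds hs₀] with s hs using hm s hs
  have hderiv : ∀ᵐ z ∂μ, ∀ s ∈ Metric.ball s₀ r, HasDerivAt (fun s => I s z)
      (deriv (fun s => I s z) s) s := by
    filter_upwards [hd] with z hz s hs
    exact (hz.differentiableAt (hW.mem_nhds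
      (hsub (Metric.ball_subset_ball (by linarith) hs)))).hasDerivAt
  have hint : Integrable (I s₀) μ := by
    refine hg.mono' (hm s₀ hs₀) ?_
    filter_upwards [hbd] with z hz using hz s₀ (Metric.mem_ball_self hr₁) hs₀
  -- The derivative is an almost everywhere limit of difference quotients along a sequence tending
  -- to `s₀`.
  have hmd : AEStronglyMeasurable (fun z => deriv (fun s => I s z) s₀) μ := by
    have hseq : Tendsto (fun n : ℕ => s₀ + (r * (1 / ((n : ℝ) + 1)) : ℝ)) atTop (𝓝[≠] s₀) := by
      refine tendsto_nhdsWithin_iff.2 ⟨?_, Eventually.of_forall fun n => ?_⟩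
      · have h1 := (tendsto_one_div_add_atTop_nhds_zero_nat (𝕜 := ℝ)).const_mul r
        have h2 := ((Complex.continuous_ofReal.tendsto _).comp h1).const_add s₀
        simpa using h2
      · have : (r * (1 / ((n : ℝ) + 1)) : ℝ) ≠ 0 := by positivity
        rw [mem_compl_singleton_iff, Ne, add_eq_left, Complex.ofReal_eq_zero]
        exact this
    refine aestronglyMeasurable_of_tendsto_ae atTop
      (f := fun (n : ℕ) z => slope (fun s => I s z) s₀ (s₀ + (r * (1 / ((n : ℝ) + 1)) : ℝ))) ?_ ?_
    · intro n
      have hmem : s₀ + (r * (1 / ((n : ℝ) + 1)) : ℝ) ∈ W := by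
        apply hsub
        rw [Metric.mem_ball, dist_self_add_left, Complex.norm_real,
          Real.norm_of_nonneg (by positivity)]
        have : 1 / ((n : ℝ) + 1) ≤ 1 := by
          rw [div_le_one (by positivity)]; linarith [n.cast_nonneg (α := ℝ)]
        nlinarith
      simp only [slope_def_module]
      exact ((hm _ hmem).sub (hm _ hs₀)).const_smul
        ((s₀ + (r * (1 / ((n : ℝ) + 1)) : ℝ) - s₀)⁻¹)
    · filter_upwards [hderiv] with z hz
      exact (hasDerivAt_iff_tendsto_slope.1 (hz s₀ (Metric.mem_ball_self hr0))).comp hseq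
  -- Cauchy's estimate on circles of radius `r` turns the bound `g` for the integrand into the bound
  -- `g / r` for its derivative.
  refine (hasDerivAt_integral_of_dominated_loc_of_deriv_le (bound := fun z => g z / r)
    (F' := fun s z => deriv (fun s => I s z) s)
    (Metric.ball_mem_nhds s₀ hr0) hmeas hint hmd ?_ (hg.div_const r)
    hderiv).2.differentiableAt.differentiableWithinAt
  filter_upwards [hd, hbd] with z hz hbz s hs
  refine Complex.norm_deriv_le_of_forall_mem_sphere_norm_le hr0 ?_ ?_
  · refine DifferentiableOn.diffContOnCl (hz.mono ?_)
    refine (Metric.closure_ball_subset_closedBall).trans fun w hw => hsub ?_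
    rw [Metric.mem_ball] at hs ⊢
    rw [Metric.mem_closedBall] at hw
    linarith [dist_triangle w s s₀]
  · intro w hw
    have : w ∈ Metric.ball s₀ (2 * r) := by
      rw [Metric.mem_ball] at hs ⊢
      rw [Metric.mem_sphere] at hw
      linarith [dist_triangle w s s₀]
    exact hbz w (Metric.ball_subset_ball hr1 this) (hsub this)

/-! ### Complex powers and general properties of the zeta function -/

/-- `|t| ^ s`, with the value `0` at `t = 0` for every exponent. -/
def absCpow (t : ℝ) (s : ℂ) : ℂ := if t = 0 then 0 else ((|t| : ℝ) : ℂ) ^ s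

lemma absCpow_eq (t : ℝ) {s : ℂ} (hs : s ≠ 0) : absCpow t s = ((|t| : ℝ) : ℂ) ^ s := by
  unfold absCpow
  split_ifs with h
  · simp [h, hs]
  · rfl

lemma norm_absCpow {t : ℝ} (ht : t ≠ 0) (s : ℂ) : ‖absCpow t s‖ = |t| ^ s.re := by
  rw [absCpow, if_neg ht, Complex.norm_cpow_eq_rpow_re_of_pos (abs_pos.2 ht)]

lemma norm_absCpow_le (t : ℝ) (s : ℂ) : ‖absCpow t s‖ ≤ |t| ^ s.re := by
  by_cases ht : t = 0
  · rw [absCpow, if_pos ht, norm_zero]; positivity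
  · exact (norm_absCpow ht s).le

lemma absCpow_ofReal {t : ℝ} {s : ℝ} (hs : s ≠ 0) :
    absCpow t (s : ℂ) = ((|t| ^ s : ℝ) : ℂ) := by
  rw [absCpow_eq t (by simpa using hs), Complex.ofReal_cpow (abs_nonneg t)]

lemma absCpow_mul (t u : ℝ) (s : ℂ) : absCpow (t * u) s = absCpow t s * absCpow u s := by
  unfold absCpow
  by_cases ht : t = 0
  · simp [ht]
  by_cases hu : u = 0
  · simp [hu]
  simp only [mul_eq_zero, ht, hu, or_self, if_false, abs_mul]
  rw [Complex.ofReal_mul, Complex.mul_cpow_ofReal_nonneg (abs_nonneg _) (abs_nonneg _)]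

/-- This is the purpose of the convention at `t = 0`: Mathlib's `0 ^ s` jumps to `1` at `s = 0` and
is not holomorphic there. -/
lemma differentiable_absCpow (t : ℝ) : Differentiable ℂ (fun s => absCpow t s) := by
  unfold absCpow
  by_cases ht : t = 0
  · simp [ht]
  · simp only [ht, if_false]
    intro s
    exact (differentiableAt_id).const_cpow (Or.inl (by simpa using ht))

lemma measurable_absCpow (s : ℂ) : Measurable (fun t => absCpow t s) := by
  unfold absCpow
  refine Measurable.ite (measurableSet_singleton 0) measurable_const ?_
  fun_prop

/-- A domination uniform in the exponent: the first summand serves `t ≤ 1`, the second `t ≥ 1`. -/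
lemma rpow_le_add_of_lt {t σ₁ σ : ℝ} (ht : 0 < t) (h1 : σ₁ ≤ σ) (h2 : σ ≤ 1) :
    t ^ σ ≤ t ^ σ₁ + t := by
  have h3 : 0 < t ^ σ₁ := by positivity
  rcases le_total t 1 with h | h
  · linarith [Real.rpow_le_rpow_of_exponent_ge ht h h1]
  · have := Real.rpow_le_rpow_of_exponent_le h h2
    rw [Real.rpow_one] at this
    linarith

lemma exists_ball_re_gt {σ₀ : ℝ} (hσ₀ : 0 < σ₀) {s₀ : ℂ} (h : -σ₀ < s₀.re) :
    ∃ σ₁, -σ₀ < σ₁ ∧ σ₁ < 0 ∧ ∃ r > 0, ∀ s ∈ Metric.ball s₀ r, σ₁ < s.re := by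
  -- The midpoint of `-σ₀` and `min (Re s₀) 0` is negative and lies strictly between `-σ₀` and `Re
  -- s₀`.
  refine ⟨(-σ₀ + min s₀.re 0) / 2, ?_, ?_, s₀.re - (-σ₀ + min s₀.re 0) / 2, ?_, ?_⟩
  · have : -σ₀ < min s₀.re 0 := lt_min h (by linarith)
    linarith
  · linarith [min_le_right s₀.re 0]
  · linarith [min_le_left s₀.re 0]
  · intro s hs
    rw [Metric.mem_ball, dist_eq_norm] at hs
    have h1 := (Complex.abs_re_le_norm (s - s₀)).trans_lt hs
    rw [abs_lt, Complex.sub_re] at h1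
    linarith [h1.1]

lemma continuous_absCpow {s : ℂ} (hs : 0 < s.re) : Continuous (fun t => absCpow t s) := by
  have hs0 : s ≠ 0 := by rintro rfl; simp at hs
  refine continuous_iff_continuousAt.2 fun t => ?_
  by_cases ht : t = 0
  · have h0 : absCpow t s = 0 := if_pos ht
    rw [ContinuousAt, h0, tendsto_zero_iff_norm_tendsto_zero]
    have h3 : Continuous fun w : ℝ => |w| ^ s.re := continuous_abs.rpow_const fun _ => Or.inr hs.le
    have h4 : Tendsto (fun w : ℝ => |w| ^ s.re) (𝓝 t) (𝓝 0) := by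
      have h5 := h3.tendsto t
      simp only [ht, abs_zero, Real.zero_rpow hs.ne'] at h5 ⊢
      exact h5
    exact squeeze_zero (fun _ => norm_nonneg _) (fun w => norm_absCpow_le w s) h4
  · have h1 : Continuous fun t : ℝ => ((|t| : ℝ) : ℂ) := by fun_prop
    have h2 := ContinuousAt.cpow h1.continuousAt (continuousAt_const (y := s))
      (Or.inl (by simpa using ht) : ((|t| : ℝ) : ℂ) ∈ Complex.slitPlane)
    exact h2.congr (Eventually.of_forall fun w => (absCpow_eq w hs0).symm)

lemma absCpow_pow {a : ℕ} (ha : a ≠ 0) (t : ℝ) (s : ℂ) :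
    absCpow (t ^ a) s = absCpow t (a * s) := by
  unfold absCpow
  by_cases ht : t = 0
  · simp [ht, ha]
  · simp only [pow_eq_zero_iff ha, ht, if_false, abs_pow]
    rw [Complex.cpow_nat_mul]
    clear ha
    induction a with
    | zero => simp
    | succ n ih =>
      rw [pow_succ, Complex.ofReal_mul, Complex.mul_cpow_ofReal_nonneg (by positivity)
        (abs_nonneg _), ih, pow_succ]

lemma absCpow_add_two (t : ℝ) (s : ℂ) : absCpow t (s + 2) = t * (t * absCpow t s) := by
  unfold absCpow
  by_cases ht : t = 0
  · simp [ht]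
  · simp only [ht, if_false]
    have h2 : ((|t| : ℝ) : ℂ) ^ (2 : ℂ) = t * t := by
      rw [show (2 : ℂ) = ((2 : ℕ) : ℂ) by norm_num, Complex.cpow_natCast, ← Complex.ofReal_pow,
        sq_abs]
      push_cast; ring
    rw [Complex.cpow_add _ _ (by simpa using ht), h2]
    ring

variable {f φ : ℝ × ℝ → ℝ} {s : ℂ}

lemma integrable_of_re_pos (hf : Continuous f) (hφ : Continuous φ) (hc : HasCompactSupport φ)
    (hs : 0 < s.re) : Integrable (fun z => absCpow (f z) s * (φ z : ℂ)) := by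
  refine Continuous.integrable_of_hasCompactSupport
    (((continuous_absCpow hs).comp hf).mul (by fun_prop)) (hc.mono fun z hz => ?_)
  rw [Function.mem_support] at hz ⊢
  intro h
  exact hz (by simp [h])

lemma zeta_eq (hs : 0 < s.re) : zeta f φ s = ∫ z, absCpow (f z) s * (φ z : ℂ) := by
  have hs0 : s ≠ 0 := by rintro rfl; simp at hs
  unfold zeta
  congr 1
  funext z
  rw [absCpow_eq _ hs0]

/-- Holomorphy of the zeta function where `|f| ^ σ` is locally integrable. -/
lemma differentiableOn_of_locallyIntegrable (hf : Continuous f) (hφ : Continuous φ)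
    (hc : HasCompactSupport φ) {σ₀ : ℝ} (hσ₀ : 0 < σ₀)
    (hint : ∀ σ, -σ₀ < σ → σ < 0 → LocallyIntegrable (fun z => |f z| ^ σ)) :
    DifferentiableOn ℂ (fun s => ∫ z, absCpow (f z) s * (φ z : ℂ)) (strip (-σ₀) 1) := by
  refine differentiableOn_integral_of_dominated (isOpen_strip _ _) ?_ ?_ ?_
  · intro s _
    exact (((measurable_absCpow s).comp hf.measurable).mul (by fun_prop)).aestronglyMeasurable
  · refine Eventually.of_forall fun z => ?_
    exact ((differentiable_absCpow _).mul_const _).differentiableOn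
  · intro s₀ hs₀
    obtain ⟨σ₁, h1, h2, r, hr, hball⟩ := exists_ball_re_gt hσ₀ hs₀.1
    refine ⟨r, hr, fun z => |φ z| * (|f z| ^ σ₁ + |f z|), ?_, Eventually.of_forall ?_⟩
    · exact ((hint σ₁ h1 h2).add hf.abs.locallyIntegrable).integrable_smul_left_of_hasCompactSupport
        hφ.abs hc.abs
    · intro z s hs hsW
      rw [norm_mul, Complex.norm_real, Real.norm_eq_abs, mul_comm]
      refine mul_le_mul_of_nonneg_left ?_ (abs_nonneg _)
      by_cases hz : f z = 0
      · rw [absCpow, if_pos hz, norm_zero]; positivity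
      · rw [norm_absCpow hz]
        exact rpow_le_add_of_lt (abs_pos.2 hz) (hball s hs).le hsW.2.le

lemma differentiableOn_zeta (hf : Continuous f) (hφ : Continuous φ)
    (hc : HasCompactSupport φ) : DifferentiableOn ℂ (zeta f φ) {s | 0 < s.re} := by
  have hopen : IsOpen {s : ℂ | 0 < s.re} := isOpen_lt continuous_const Complex.continuous_re
  have : DifferentiableOn ℂ (fun s => ∫ z, absCpow (f z) s * (φ z : ℂ)) {s | 0 < s.re} := by
    refine differentiableOn_integral_of_dominated hopen ?_ ?_ ?_
    · intro s _
      exact (((measurable_absCpow s).comp hf.measurable).mul (by fun_prop)).aestronglyMeasurable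
    · refine Eventually.of_forall fun z => ?_
      exact ((differentiable_absCpow _).mul_const _).differentiableOn
    · intro s₀ (hs₀ : 0 < s₀.re)
      -- On the ball of radius `Re s₀` the exponent has real part below `2 Re s₀`; the summand `1`
      -- covers `|f| ≤ 1`.
      have hcont : Continuous fun z => |φ z| * (1 + |f z| ^ (2 * s₀.re)) := by
        refine hφ.abs.mul (continuous_const.add (hf.abs.rpow_const fun _ => Or.inr (by linarith)))
      refine ⟨s₀.re, hs₀, fun z => |φ z| * (1 + |f z| ^ (2 * s₀.re)),
        hcont.integrable_of_hasCompactSupport hc.abs.mul_right, Eventually.of_forall ?_⟩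
      intro z s hs hsW
      rw [norm_mul, Complex.norm_real, Real.norm_eq_abs, mul_comm]
      refine mul_le_mul_of_nonneg_left ?_ (abs_nonneg _)
      refine (norm_absCpow_le _ _).trans ?_
      rw [Metric.mem_ball, dist_eq_norm] at hs
      have h1 := (Complex.abs_re_le_norm (s - s₀)).trans_lt hs
      rw [abs_lt, Complex.sub_re] at h1
      have hsW' : 0 < s.re := hsW
      have h3 : 0 ≤ |f z| ^ (2 * s₀.re) := by positivity
      rcases le_total |f z| 1 with h | h
      · linarith [Real.rpow_le_one (abs_nonneg (f z)) h hsW'.le]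
      · linarith [Real.rpow_le_rpow_of_exponent_le h (show s.re ≤ 2 * s₀.re by linarith)]
  exact this.congr fun s hs => zeta_eq hs

/-- Glues `G` on the strip to the zeta function on `Re s > 0`, so that domination is only needed for
`Re s < 1`. -/
lemma hasMeromorphicContinuation_of_strip (hf : Continuous f) (hφ : Continuous φ)
    (hc : HasCompactSupport φ) {ρ : ℝ} {G : ℂ → ℂ} (hG : MeromorphicOn G (strip (-ρ) 1))
    (h : ∀ s ∈ strip 0 1, G s = zeta f φ s) : HasMeromorphicContinuation f φ ρ := by
  classical
  refine ⟨fun s => if 0 < s.re then zeta f φ s else G s, ?_, fun s hs => if_pos hs⟩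
  intro s hs
  by_cases hs1 : s.re < 1
  · refine (hG s ⟨hs, hs1⟩).congr ?_
    refine Filter.EventuallyEq.filter_mono ?_ nhdsWithin_le_nhds
    filter_upwards [(isOpen_lt Complex.continuous_re continuous_const).mem_nhds hs1] with z hz
    split_ifs with h0
    · exact h z ⟨h0, hz⟩
    · rfl
  · have hs0 : s ∈ {s : ℂ | 0 < s.re} := by
      simp only [mem_ofPred_eq]; linarith
    have hopen : IsOpen {s : ℂ | 0 < s.re} := isOpen_lt continuous_const Complex.continuous_re
    refine ((differentiableOn_zeta hf hφ hc).analyticAt (hopen.mem_nhds hs0)).meromorphicAt.congr ?_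
    refine Filter.EventuallyEq.filter_mono ?_ nhdsWithin_le_nhds
    filter_upwards [hopen.mem_nhds hs0] with z hz
    exact (if_pos hz).symm

lemma m0_eq {V : Set (ℝ × ℝ)} {σ : ℝ} (hσ : 0 < σ)
    (h1 : ∀ φ ∈ testFunctions V, HasMeromorphicContinuation f φ σ)
    (h2 : ∃ φ ∈ testFunctions V, ∀ ρ, σ < ρ → ¬ HasMeromorphicContinuation f φ ρ) :
    m0 V f = ENNReal.ofReal σ := by
  refine le_antisymm ?_ ?_
  · obtain ⟨φ, hφ, hn⟩ := h2
    have hle : m0 V f ≤ m0Test f φ := sInf_le ⟨φ, hφ, rfl⟩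
    refine hle.trans (sSup_le ?_)
    rintro _ ⟨ρ, _, hρ, rfl⟩
    refine ENNReal.ofReal_le_ofReal (not_lt.1 fun h => hn ρ h hρ)
  · refine le_sInf ?_
    rintro _ ⟨φ, hφ, rfl⟩
    exact le_sSup ⟨σ, hσ, h1 φ hφ, rfl⟩

/-! ### Meromorphic continuation of the monomial zeta function -/

lemma hasDerivAt_mul_absCpow {w : ℂ} (hw : 0 < w.re) (y : ℝ) :
    HasDerivAt (fun t : ℝ => (t : ℂ) * absCpow t w) ((w + 1) * absCpow y w) y := by
  have hw0 : w ≠ 0 := by rintro rfl; simp at hw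
  have hw1 : w + 1 ≠ 0 := by
    intro h
    have := congrArg Complex.re h
    simp at this; linarith
  have hpos : ∀ x : ℝ, 0 < x →
      HasDerivAt (fun t : ℝ => (t : ℂ) ^ (w + 1)) ((w + 1) * (x : ℂ) ^ w) x := by
    intro x hx
    have h := hasDerivAt_ofReal_cpow_const hx.ne' hw1
    rwa [add_sub_cancel_right] at h
  have hval : ∀ x : ℝ, 0 < x → (x : ℂ) * absCpow x w = (x : ℂ) ^ (w + 1) := by
    intro x hx
    rw [absCpow_eq _ hw0, abs_of_pos hx, Complex.cpow_add _ _ (by simpa using hx.ne'),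
      Complex.cpow_one, mul_comm]
  rcases lt_trichotomy y 0 with hy | rfl | hy
  · have h := ((hpos (-y) (by linarith)).scomp y (hasDerivAt_neg y)).neg
    have e : ((w + 1) * absCpow y w) = -((-1 : ℝ) • ((w + 1) * ((-y : ℝ) : ℂ) ^ w)) := by
      rw [absCpow_eq _ hw0, abs_of_neg hy]; simp
    rw [e]
    refine h.congr_of_eventuallyEq ?_
    filter_upwards [isOpen_Iio.mem_nhds hy] with t ht
    have ht' : 0 < -t := by simpa using ht
    have := hval (-t) ht'
    simp only [Pi.neg_apply, Function.comp_apply]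
    rw [← this, absCpow_eq _ hw0, absCpow_eq _ hw0, abs_neg]
    push_cast; ring
  -- At the origin the difference quotient is `|t| ^ w` itself, which tends to `0` because `Re w >
  -- 0`.
  · rw [hasDerivAt_iff_tendsto_slope]
    have h0 : absCpow 0 w = 0 := if_pos rfl
    have h1 : Tendsto (fun t => absCpow t w) (𝓝[≠] 0) (𝓝 ((w + 1) * absCpow 0 w)) := by
      have := (continuous_absCpow hw).tendsto 0
      rw [h0] at this
      rw [h0, mul_zero]
      exact this.mono_left nhdsWithin_le_nhds
    refine h1.congr' ?_
    filter_upwards [self_mem_nhdsWithin] with t (ht : t ≠ 0)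
    rw [slope_def_module, h0]
    have : (t : ℂ) ≠ 0 := by exact_mod_cast ht
    simp [Complex.real_smul, this]
  · have e : ((w + 1) * absCpow y w) = ((w + 1) * (y : ℂ) ^ w) := by
      rw [absCpow_eq _ hw0, abs_of_pos hy]
    rw [e]
    refine (hpos y hy).congr_of_eventuallyEq ?_
    filter_upwards [isOpen_Ioi.mem_nhds hy] with t ht
    exact hval t ht

lemma hasDerivAt_absCpow_add_two {w : ℂ} (hw : 0 < w.re) (y : ℝ) :
    HasDerivAt (fun t : ℝ => absCpow t (w + 2)) ((w + 2) * ((y : ℂ) * absCpow y w)) y := by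
  have h := (Complex.ofRealCLM.hasDerivAt (x := y)).fun_mul (hasDerivAt_mul_absCpow hw y)
  have e : (fun t : ℝ => absCpow t (w + 2)) =
      fun t : ℝ => Complex.ofRealCLM t * ((t : ℂ) * absCpow t w) := by
    funext t
    rw [absCpow_add_two]; simp
  rw [e]
  refine h.congr_deriv ?_
  simp only [Complex.ofRealCLM_apply, Complex.ofReal_one]
  ring

variable {φ : ℝ × ℝ → ℝ}

lemma integral_mul_deriv_snd {g u u' : ℝ → ℂ} (hg : Continuous g) (hu : ∀ y, HasDerivAt u (u' y) y)
    (hu' : Continuous u') (hφ : ContDiff ℝ ∞ φ) (hc : HasCompactSupport φ) :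
    ∫ z : ℝ × ℝ, g z.1 * u' z.2 * (φ z : ℂ) =
      -∫ z : ℝ × ℝ, g z.1 * u z.2 * ((fderiv ℝ φ z (0, 1) : ℝ) : ℂ) := by
  have huc : Continuous u := continuous_iff_continuousAt.2 fun y => (hu y).continuousAt
  have hφ' : Continuous fun z => fderiv ℝ φ z (0, 1) :=
    (hφ.continuous_fderiv (by simp)).clm_apply continuous_const
  have hφc := hφ.continuous
  have hc' : HasCompactSupport fun z => fderiv ℝ φ z (0, 1) := hc.fderiv_apply ℝ (0, 1)
  have key := integral_bilinear_hasLineDerivAt_right_eq_neg_left_of_integrable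
    (μ := (volume : Measure (ℝ × ℝ))) (B := ContinuousLinearMap.mul ℝ ℂ)
    (f := fun z : ℝ × ℝ => (φ z : ℂ)) (f' := fun z => ((fderiv ℝ φ z (0, 1) : ℝ) : ℂ))
    (g := fun z : ℝ × ℝ => g z.1 * u z.2) (g' := fun z => g z.1 * u' z.2) (v := (0, 1))
    ?_ ?_ ?_ ?_ ?_
  · simpa [mul_comm, mul_left_comm, mul_assoc] using key
  · refine Continuous.integrable_of_hasCompactSupport (by simp; fun_prop) ?_
    exact (hc'.comp_left (g := ((↑) : ℝ → ℂ)) Complex.ofReal_zero).mul_right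
  · refine Continuous.integrable_of_hasCompactSupport (by simp; fun_prop) ?_
    exact (hc.comp_left (g := ((↑) : ℝ → ℂ)) Complex.ofReal_zero).mul_right
  · refine Continuous.integrable_of_hasCompactSupport (by simp; fun_prop) ?_
    exact (hc.comp_left (g := ((↑) : ℝ → ℂ)) Complex.ofReal_zero).mul_right
  · intro z _
    exact HasDerivAt.ofReal_comp
      ((hφ.differentiable (by simp)).differentiableAt.hasFDerivAt.hasLineDerivAt (0, 1))
  · intro z _
    have h1 : HasDerivAt (fun t : ℝ => z.2 + t) 1 0 := (hasDerivAt_id 0).const_add z.2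
    have h2 : HasDerivAt u (u' z.2) (z.2 + 0) := by simpa using hu z.2
    have h3 := (h2.scomp 0 h1).const_mul (g z.1)
    unfold HasLineDerivAt
    simpa [Function.comp_def] using h3

/-- `∫ |x| ^ w₁ |y| ^ w₂ φ(x, y)`. -/
def monomialIntegral (w₁ w₂ : ℂ) (φ : ℝ × ℝ → ℝ) : ℂ :=
  ∫ z : ℝ × ℝ, absCpow z.1 w₁ * absCpow z.2 w₂ * (φ z : ℂ)

/-- Two integrations by parts in `y`: `(w+1)|y|^w` is the derivative of `y|y|^w`, and `(w+2) y|y|^w`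
that of `|y|^(w+2)`. The signs cancel and `φ'` is the second `y`-derivative of `φ`. -/
lemma monomialIntegral_shift_snd (hφ : ContDiff ℝ ∞ φ) (hc : HasCompactSupport φ) :
    ∃ φ' : ℝ × ℝ → ℝ, ContDiff ℝ ∞ φ' ∧ HasCompactSupport φ' ∧ ∀ w₁ w₂ : ℂ, 0 < w₁.re →
      0 < w₂.re → monomialIntegral w₁ w₂ φ * ((w₂ + 1) * (w₂ + 2)) =
        monomialIntegral w₁ (w₂ + 2) φ' := by
  have hd : ∀ {χ : ℝ × ℝ → ℝ}, ContDiff ℝ ∞ χ → ContDiff ℝ ∞ fun z => fderiv ℝ χ z (0, 1) :=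
    fun h => (h.fderiv_right (m := ∞) (by simp)).clm_apply contDiff_const
  have hc1 : HasCompactSupport fun z => fderiv ℝ φ z (0, 1) := hc.fderiv_apply ℝ (0, 1)
  refine ⟨_, hd (hd hφ), hc1.fderiv_apply ℝ (0, 1), ?_⟩
  intro w₁ w₂ h1 h2
  have k1 := integral_mul_deriv_snd (continuous_absCpow h1) (hasDerivAt_mul_absCpow h2)
    (continuous_const.mul (continuous_absCpow h2)) hφ hc
  have k2 := integral_mul_deriv_snd (continuous_absCpow h1) (hasDerivAt_absCpow_add_two h2)
    (continuous_const.mul (Complex.continuous_ofReal.mul (continuous_absCpow h2))) (hd hφ) hc1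
  unfold monomialIntegral
  have e1 : ∫ z : ℝ × ℝ, absCpow z.1 w₁ * ((w₂ + 1) * absCpow z.2 w₂) * (φ z : ℂ) =
      (w₂ + 1) * ∫ z : ℝ × ℝ, absCpow z.1 w₁ * absCpow z.2 w₂ * (φ z : ℂ) := by
    rw [← integral_const_mul]; congr 1; funext z; ring
  have e2 : ∫ z : ℝ × ℝ, absCpow z.1 w₁ * ((w₂ + 2) * (z.2 * absCpow z.2 w₂)) *
        ((fderiv ℝ φ z (0, 1) : ℝ) : ℂ) =
      (w₂ + 2) * ∫ z : ℝ × ℝ, absCpow z.1 w₁ * (z.2 * absCpow z.2 w₂) *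
        ((fderiv ℝ φ z (0, 1) : ℝ) : ℂ) := by
    rw [← integral_const_mul]; congr 1; funext z; ring
  rw [e1] at k1
  rw [e2] at k2
  linear_combination (w₂ + 2) * k1 - k2

/-- The product `∏_{i < N} (w + 2 i + 1) (w + 2 i + 2)`. -/
def shiftFactor (N : ℕ) (w : ℂ) : ℂ := ∏ i ∈ Finset.range N, ((w + 2 * i + 1) * (w + 2 * i + 2))

lemma shiftFactor_ne_zero (N : ℕ) {w : ℂ} (hw : 0 < w.re) : shiftFactor N w ≠ 0 := by
  refine Finset.prod_ne_zero_iff.2 fun i _ => mul_ne_zero ?_ ?_ <;>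
  · intro h
    have h1 := congrArg Complex.re h
    have h2 : (0 : ℝ) ≤ i := i.cast_nonneg
    simp at h1
    linarith

lemma differentiable_shiftFactor (N : ℕ) : Differentiable ℂ (shiftFactor N) := by
  unfold shiftFactor
  fun_prop

lemma monomialIntegral_shift_snd_iterate (N : ℕ) (hφ : ContDiff ℝ ∞ φ) (hc : HasCompactSupport φ) :
    ∃ φ' : ℝ × ℝ → ℝ, ContDiff ℝ ∞ φ' ∧ HasCompactSupport φ' ∧ ∀ w₁ w₂ : ℂ, 0 < w₁.re →
      0 < w₂.re → monomialIntegral w₁ w₂ φ * shiftFactor N w₂ =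
        monomialIntegral w₁ (w₂ + 2 * N) φ' := by
  induction N with
  | zero => exact ⟨φ, hφ, hc, fun w₁ w₂ _ _ => by simp [shiftFactor]⟩
  | succ n ih =>
    obtain ⟨φ₁, h1, h2, h3⟩ := ih
    obtain ⟨φ₂, h4, h5, h6⟩ := monomialIntegral_shift_snd h1 h2
    refine ⟨φ₂, h4, h5, fun w₁ w₂ hw₁ hw₂ => ?_⟩
    have hre : 0 < (w₂ + 2 * n).re := by
      have h2 : (0 : ℝ) ≤ n := n.cast_nonneg
      simp; linarith
    have k := h6 w₁ (w₂ + 2 * n) hw₁ hre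
    rw [← h3 w₁ w₂ hw₁ hw₂] at k
    rw [show w₂ + 2 * ((n + 1 : ℕ) : ℂ) = w₂ + 2 * n + 2 by push_cast; ring, ← k]
    simp only [shiftFactor, Finset.prod_range_succ]
    ring

lemma monomialIntegral_swap (w₁ w₂ : ℂ) (φ : ℝ × ℝ → ℝ) :
    monomialIntegral w₁ w₂ φ = monomialIntegral w₂ w₁ (fun z => φ z.swap) := by
  unfold monomialIntegral
  rw [Measure.volume_eq_prod, ← integral_prod_swap]
  congr 1
  funext z
  simp only [Prod.fst_swap, Prod.snd_swap]
  ring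

lemma monomialIntegral_shift (N : ℕ) (hφ : ContDiff ℝ ∞ φ) (hc : HasCompactSupport φ) :
    ∃ φ' : ℝ × ℝ → ℝ, ContDiff ℝ ∞ φ' ∧ HasCompactSupport φ' ∧ ∀ w₁ w₂ : ℂ, 0 < w₁.re →
      0 < w₂.re → monomialIntegral w₁ w₂ φ * (shiftFactor N w₁ * shiftFactor N w₂) =
        monomialIntegral (w₁ + 2 * N) (w₂ + 2 * N) φ' := by
  have hsw : ∀ {χ : ℝ × ℝ → ℝ}, ContDiff ℝ ∞ χ → HasCompactSupport χ →
      ContDiff ℝ ∞ (fun z : ℝ × ℝ => χ z.swap) ∧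
        HasCompactSupport (fun z : ℝ × ℝ => χ z.swap) := fun h1 h2 =>
    ⟨h1.comp (contDiff_snd.prodMk contDiff_fst), h2.comp_homeomorph (Homeomorph.prodComm ℝ ℝ)⟩
  obtain ⟨φ₁, h1, h2, h3⟩ := monomialIntegral_shift_snd_iterate N hφ hc
  obtain ⟨h1', h2'⟩ := hsw h1 h2
  obtain ⟨φ₂, h4, h5, h6⟩ := monomialIntegral_shift_snd_iterate N h1' h2'
  obtain ⟨h4', h5'⟩ := hsw h4 h5
  refine ⟨_, h4', h5', fun w₁ w₂ hw₁ hw₂ => ?_⟩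
  have hre : 0 < (w₂ + 2 * N).re := by
    have h2 : (0 : ℝ) ≤ N := N.cast_nonneg
    simp; linarith
  rw [← monomialIntegral_swap, ← h6 _ _ hre hw₁, ← monomialIntegral_swap, ← h3 _ _ hw₁ hw₂]
  ring

lemma rpow_le_one_add_rpow {t e B : ℝ} (ht : 0 ≤ t) (he : 0 ≤ e) (hB : e ≤ B) :
    t ^ e ≤ (1 + t) ^ B :=
  (Real.rpow_le_rpow ht (by linarith) he).trans
    (Real.rpow_le_rpow_of_exponent_le (by linarith) hB)

/-- After raising both exponents by `2N` the integral is holomorphic on `Re s > -1`; dividing by the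
polynomial `shiftFactor`s gives the continuation, with their zeros as the only possible poles. -/
lemma exists_meromorphic_monomial {a b : ℕ} (ha : a ≠ 0) (hb : b ≠ 0) (hφ : ContDiff ℝ ∞ φ)
    (hc : HasCompactSupport φ) : ∃ M : ℂ → ℂ, MeromorphicOn M {s | -1 < s.re} ∧
      ∀ s : ℂ, 0 < s.re → M s = ∫ z : ℝ × ℝ, absCpow (z.1 ^ a * z.2 ^ b) s * (φ z : ℂ) := by
  -- Large enough that `a s + 2N` and `b s + 2N` have positive real part for `Re s > -1`.
  set N := a + b with hN
  obtain ⟨χ, h1, h2, h3⟩ := monomialIntegral_shift N hφ hc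
  have hopen : IsOpen {s : ℂ | -1 < s.re} := isOpen_lt continuous_const Complex.continuous_re
  have hD : DifferentiableOn ℂ (fun s : ℂ => monomialIntegral (a * s + 2 * N) (b * s + 2 * N) χ)
      {s | -1 < s.re} := by
    unfold monomialIntegral
    refine differentiableOn_integral_of_dominated hopen ?_ ?_ ?_
    · intro s _
      have m1 : Measurable fun z : ℝ × ℝ => absCpow z.1 (a * s + 2 * N) :=
        (measurable_absCpow _).comp measurable_fst
      have m2 : Measurable fun z : ℝ × ℝ => absCpow z.2 (b * s + 2 * N) :=
        (measurable_absCpow _).comp measurable_snd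
      exact ((m1.mul m2).mul
        (Complex.measurable_ofReal.comp h1.continuous.measurable)).aestronglyMeasurable
    · refine Eventually.of_forall fun z => Differentiable.differentiableOn ?_
      refine Differentiable.mul_const (Differentiable.mul ?_ ?_) _
      · exact (differentiable_absCpow z.1).comp (by fun_prop)
      · exact (differentiable_absCpow z.2).comp (by fun_prop)
    · intro s₀ _
      -- An upper bound for the real parts of both shifted exponents on the unit ball about `s₀`.
      set B : ℝ := N * (|s₀.re| + 1) + 2 * N with hB
      have hNn : (0 : ℝ) ≤ N := N.cast_nonneg
      have hB0 : 0 ≤ B := by positivity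
      have hcont : Continuous fun z : ℝ × ℝ => |χ z| * ((1 + |z.1|) ^ B * (1 + |z.2|) ^ B) := by
        refine h1.continuous.abs.mul (Continuous.mul ?_ ?_) <;>
          exact Continuous.rpow_const (by fun_prop) fun _ => Or.inr hB0
      refine ⟨1, one_pos, _, hcont.integrable_of_hasCompactSupport h2.abs.mul_right,
        Eventually.of_forall ?_⟩
      intro z s hs hsW
      rw [Metric.mem_ball, dist_eq_norm] at hs
      have h4 := (Complex.abs_re_le_norm (s - s₀)).trans_lt hs
      rw [abs_lt, Complex.sub_re] at h4
      have hs1 : -1 < s.re := hsW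
      have hexp : ∀ c : ℕ, c ≤ N → ∀ t : ℝ, ‖absCpow t (c * s + 2 * N)‖ ≤ (1 + |t|) ^ B := by
        intro c hcN t
        have hcN' : (c : ℝ) ≤ N := by exact_mod_cast hcN
        have hc0 : (0 : ℝ) ≤ c := c.cast_nonneg
        refine (norm_absCpow_le _ _).trans (rpow_le_one_add_rpow (abs_nonneg _) ?_ ?_)
        · simp; nlinarith
        · simp only [Complex.add_re, Complex.mul_re, Complex.natCast_re, Complex.natCast_im,
            zero_mul, sub_zero, Complex.re_ofNat, Complex.im_ofNat, hB]
          have : s.re ≤ |s₀.re| + 1 := by linarith [le_abs_self s₀.re]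
          have h5 : (c : ℝ) * s.re ≤ c * (|s₀.re| + 1) := mul_le_mul_of_nonneg_left this hc0
          have h6 : (c : ℝ) * (|s₀.re| + 1) ≤ N * (|s₀.re| + 1) :=
            mul_le_mul_of_nonneg_right hcN' (by positivity)
          linarith
      rw [norm_mul, norm_mul, Complex.norm_real, Real.norm_eq_abs, mul_comm]
      refine mul_le_mul_of_nonneg_left ?_ (abs_nonneg _)
      exact mul_le_mul (hexp a (by omega) _) (hexp b (by omega) _) (norm_nonneg _) (by positivity)
  refine ⟨fun s => monomialIntegral (a * s + 2 * N) (b * s + 2 * N) χ /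
    (shiftFactor N (a * s) * shiftFactor N (b * s)), ?_, ?_⟩
  · intro s hs
    have hS : ∀ c : ℕ, Differentiable ℂ fun s : ℂ => shiftFactor N (c * s) := fun c =>
      (differentiable_shiftFactor N).comp (by fun_prop)
    exact (hD.analyticAt (hopen.mem_nhds hs)).meromorphicAt.div
      (((hS a).mul (hS b)).analyticAt s).meromorphicAt
  · intro s hs
    have hpos : ∀ c : ℕ, c ≠ 0 → 0 < ((c : ℂ) * s).re := by
      intro c hc
      have : (0 : ℝ) < c := by positivity
      simp; positivity
    have hk := h3 (a * s) (b * s) (hpos a ha) (hpos b hb)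
    simp only
    rw [← hk, mul_div_cancel_right₀ _ (mul_ne_zero (shiftFactor_ne_zero N (hpos a ha))
      (shiftFactor_ne_zero N (hpos b hb)))]
    unfold monomialIntegral
    congr 1
    funext z
    rw [absCpow_mul, absCpow_pow ha, absCpow_pow hb]

/-! ### Explicit power integrals, box estimates and bump functions -/

lemma setLIntegral_neg (F : ℝ → ℝ≥0∞) (S : Set ℝ) :
    ∫⁻ t in Neg.neg ⁻¹' S, F (-t) = ∫⁻ t in S, F t :=
  (Measure.measurePreserving_neg (volume : Measure ℝ)).setLIntegral_comp_preimage_emb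
    (Homeomorph.neg ℝ).measurableEmbedding F S

lemma lintegral_comp_abs_eq (F : ℝ → ℝ≥0∞) : ∫⁻ t, F |t| = 2 * ∫⁻ t in Ioi 0, F t := by
  have h1 : ∫⁻ t in Iio 0, F |t| = ∫⁻ t in Ioi 0, F t := by
    rw [← setLIntegral_neg F (Ioi 0), show Neg.neg ⁻¹' Ioi (0 : ℝ) = Iio 0 by ext; simp]
    refine setLIntegral_congr_fun measurableSet_Iio fun t ht => ?_
    simp only [abs_of_neg (show t < 0 from ht)]
  have h2 : ∫⁻ t in Ici 0, F |t| = ∫⁻ t in Ioi 0, F t := by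
    rw [setLIntegral_congr Ioi_ae_eq_Ici.symm]
    refine setLIntegral_congr_fun measurableSet_Ioi fun t ht => ?_
    simp only [abs_of_pos (show 0 < t from ht)]
  rw [← lintegral_add_compl _ (measurableSet_Ici (a := (0 : ℝ))), compl_Ici, h1, h2, two_mul]

lemma lintegral_Ioc_zero_rpow {α c : ℝ} (hα : -1 < α) (hc : 0 ≤ c) :
    ∫⁻ t in Ioc 0 c, ENNReal.ofReal (t ^ α) = ENNReal.ofReal (c ^ (α + 1) / (α + 1)) := by
  have hi : IntervalIntegrable (fun t : ℝ => t ^ α) volume 0 c :=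
    intervalIntegral.intervalIntegrable_rpow' hα
  rw [intervalIntegrable_iff_integrableOn_Ioc_of_le hc] at hi
  rw [← ofReal_integral_eq_lintegral_ofReal hi, ← intervalIntegral.integral_of_le hc,
    integral_rpow (Or.inl hα), Real.zero_rpow (by linarith), sub_zero]
  filter_upwards [ae_restrict_mem measurableSet_Ioc] with t ht
  exact Real.rpow_nonneg ht.1.le _

lemma lintegral_Ioc_rpow_sub_one {d c r : ℝ} (hd : d ≠ 0) (hc : 0 < c) (hr : c ≤ r) :
    ∫⁻ t in Ioc c r, ENNReal.ofReal (t ^ (d - 1)) = ENNReal.ofReal ((r ^ d - c ^ d) / d) := by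
  have h0 : (0 : ℝ) ∉ uIcc c r := by
    rw [uIcc_of_le hr]; intro h; linarith [h.1]
  have hi : IntervalIntegrable (fun t : ℝ => t ^ (d - 1)) volume c r :=
    intervalIntegral.intervalIntegrable_rpow (Or.inr h0)
  rw [intervalIntegrable_iff_integrableOn_Ioc_of_le hr] at hi
  rw [← ofReal_integral_eq_lintegral_ofReal hi, ← intervalIntegral.integral_of_le hr,
    integral_rpow (Or.inr ⟨by simpa using hd, h0⟩), sub_add_cancel]
  filter_upwards [ae_restrict_mem measurableSet_Ioc] with t ht
  exact Real.rpow_nonneg (hc.trans ht.1).le _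

lemma lintegral_Ioi_rpow {β c : ℝ} (hβ : β < -1) (hc : 0 < c) :
    ∫⁻ t in Ioi c, ENNReal.ofReal (t ^ β) = ENNReal.ofReal (c ^ (β + 1) / (-(β + 1))) := by
  rw [← ofReal_integral_eq_lintegral_ofReal (integrableOn_Ioi_rpow_of_lt hβ hc),
    integral_Ioi_rpow_of_lt hβ hc, neg_div, div_neg]
  filter_upwards [ae_restrict_mem measurableSet_Ioi] with t ht
  exact Real.rpow_nonneg (hc.trans ht).le _

/-- A power cut off at the scale `η`. -/
lemma lintegral_rpow_mul_min_le {α κ η : ℝ} (hα : -1 < α) (hκ : α + 1 < κ) (hη : 0 < η) :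
    ∫⁻ t : ℝ, ENNReal.ofReal (|t| ^ α * min 1 ((η / |t|) ^ κ)) ≤
      ENNReal.ofReal (2 * η ^ (α + 1) * (1 / (α + 1) + 1 / (κ - α - 1))) := by
  -- The integral is split at `t = η`: below it the minimum is replaced by `1`, above it by `(η / t)
  -- ^ κ`. The two terms on the right are the two pieces.
  rw [lintegral_comp_abs_eq (fun t => ENNReal.ofReal (t ^ α * min 1 ((η / t) ^ κ))),
    ← Ioc_union_Ioi_eq_Ioi hη.le,
    lintegral_union measurableSet_Ioi (disjoint_left.2 fun t h1 h2 => not_lt.2 h1.2 h2)]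
  have h1 : ∫⁻ t in Ioc 0 η, ENNReal.ofReal (t ^ α * min 1 ((η / t) ^ κ)) ≤
      ENNReal.ofReal (η ^ (α + 1) * (1 / (α + 1))) := by
    rw [mul_one_div, ← lintegral_Ioc_zero_rpow hα hη.le]
    refine setLIntegral_mono' measurableSet_Ioc fun t ht => ENNReal.ofReal_le_ofReal ?_
    exact mul_le_of_le_one_right (Real.rpow_nonneg ht.1.le _) (min_le_left _ _)
  have h2 : ∫⁻ t in Ioi η, ENNReal.ofReal (t ^ α * min 1 ((η / t) ^ κ)) ≤
      ENNReal.ofReal (η ^ (α + 1) * (1 / (κ - α - 1))) := by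
    calc _ ≤ ∫⁻ t in Ioi η, ENNReal.ofReal (η ^ κ) * ENNReal.ofReal (t ^ (α - κ)) := by
          refine setLIntegral_mono' measurableSet_Ioi fun t ht => ?_
          have ht0 : 0 < t := hη.trans ht
          rw [← ENNReal.ofReal_mul (by positivity)]
          refine ENNReal.ofReal_le_ofReal ?_
          calc t ^ α * min 1 ((η / t) ^ κ) ≤ t ^ α * (η / t) ^ κ := by
                gcongr; exact min_le_right _ _
            _ = η ^ κ * t ^ (α - κ) := by
                rw [Real.div_rpow hη.le ht0.le, Real.rpow_sub ht0]; ring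
      _ = _ := by
          rw [lintegral_const_mul _ (by fun_prop), lintegral_Ioi_rpow (by linarith) hη,
            ← ENNReal.ofReal_mul (by positivity)]
          congr 1
          rw [mul_div_assoc', ← Real.rpow_add hη]
          rw [show κ + (α - κ + 1) = α + 1 by ring, show -(α - κ + 1) = κ - α - 1 by ring,
            mul_one_div]
  have hp1 : 0 < α + 1 := by linarith
  have hp2 : 0 < κ - α - 1 := by linarith
  calc _ ≤ 2 * (ENNReal.ofReal (η ^ (α + 1) * (1 / (α + 1))) +
        ENNReal.ofReal (η ^ (α + 1) * (1 / (κ - α - 1)))) := by gcongr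
    _ = _ := by
        rw [← ENNReal.ofReal_add (by positivity) (by positivity),
          show (2 : ℝ≥0∞) = ENNReal.ofReal 2 by simp, ← ENNReal.ofReal_mul (by norm_num)]
        congr 1; ring

lemma lintegral_Icc_abs_rpow_lt_top {α R : ℝ} (hα : -1 < α) (hR : 0 ≤ R) :
    ∫⁻ t in Icc (-R) R, ENNReal.ofReal (|t| ^ α) < ⊤ := by
  have h : ∫⁻ t in Icc (-R) R, ENNReal.ofReal (|t| ^ α) =
      ∫⁻ t, (fun u => (Iic R).indicator (fun u => ENNReal.ofReal (u ^ α)) u) |t| := by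
    rw [← lintegral_indicator measurableSet_Icc]
    congr 1
    funext t
    simp only [indicator, mem_Icc, mem_Iic, abs_le]
  rw [h, lintegral_comp_abs_eq, setLIntegral_indicator measurableSet_Iic, inter_comm,
    show Ioi (0 : ℝ) ∩ Iic R = Ioc 0 R from Ioi_inter_Iic, lintegral_Ioc_zero_rpow hα hR]
  exact ENNReal.mul_lt_top ENNReal.ofNat_lt_top ENNReal.ofReal_lt_top

/-- From `d log d ≥ d - 1 ≥ -1`. It makes a correction of order `d` in the exponent of a power of
`d` harmless. -/
lemma exp_neg_le_rpow_self_mul {d K : ℝ} (hd : 0 < d) (hK : 0 ≤ K) :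
    Real.exp (-K) ≤ d ^ (K * d) := by
  rw [Real.rpow_def_of_pos hd]
  refine Real.exp_le_exp.2 ?_
  have h := Real.one_sub_inv_le_log_of_pos hd
  have h2 : d * (1 - d⁻¹) ≤ d * Real.log d := mul_le_mul_of_nonneg_left h hd.le
  rw [mul_sub, mul_inv_cancel₀ hd.ne'] at h2
  nlinarith

/-- The lower integral of a power over a box. -/
lemma le_lintegral_box {g : ℝ × ℝ → ℝ≥0∞} {S T : Set ℝ} (hS : MeasurableSet S)
    (hT : MeasurableSet T) {u : ℝ → ℝ≥0∞} (hu : Measurable u)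
    (h : ∀ x ∈ S, ∀ y ∈ T, u x ≤ g (x, y)) :
    (∫⁻ x in S, u x) * volume T ≤ ∫⁻ z, g z := by
  calc (∫⁻ x in S, u x) * volume T
      = ∫⁻ z, u z.1 ∂((volume.restrict S).prod (volume.restrict T)) := by
        rw [lintegral_prod (fun z : ℝ × ℝ => u z.1) (hu.comp measurable_fst).aemeasurable]
        simp only [lintegral_const, Measure.restrict_apply_univ]
        rw [lintegral_mul_const _ hu]
    _ = ∫⁻ z in S ×ˢ T, u z.1 := by rw [Measure.prod_restrict, ← Measure.volume_eq_prod]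
    _ ≤ ∫⁻ z in S ×ˢ T, g z :=
        setLIntegral_mono' (hS.prod hT) fun z hz => h z.1 hz.1 z.2 hz.2
    _ ≤ ∫⁻ z, g z := setLIntegral_le_lintegral _ _

lemma ae_fst_ne_zero : ∀ᵐ z : ℝ × ℝ, z.1 ≠ 0 :=
  Measure.quasiMeasurePreserving_fst.ae (Measure.ae_ne volume (0 : ℝ))

lemma ae_snd_ne_zero : ∀ᵐ z : ℝ × ℝ, z.2 ≠ 0 :=
  Measure.quasiMeasurePreserving_snd.ae (Measure.ae_ne volume (0 : ℝ))

/-- The upper bound also supplies the finiteness without which the Bochner integral would be `0` by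
convention and the lower bound would be lost. -/
lemma abs_integral_bounds {g : ℝ × ℝ → ℝ} (hg : AEStronglyMeasurable g)
    (hn : ∀ᵐ z, 0 ≤ g z) {l u : ℝ} (hl : ENNReal.ofReal l ≤ ∫⁻ z, ENNReal.ofReal (g z))
    (hu : ∫⁻ z, ENNReal.ofReal (g z) ≤ ENNReal.ofReal u) (hu0 : 0 ≤ u) :
    l ≤ ‖((∫ z, g z : ℝ) : ℂ)‖ ∧ ‖((∫ z, g z : ℝ) : ℂ)‖ ≤ u := by
  have hI : ∫ z, g z = (∫⁻ z, ENNReal.ofReal (g z)).toReal :=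
    integral_eq_lintegral_of_nonneg_ae hn hg
  have htop : ∫⁻ z, ENNReal.ofReal (g z) ≠ ⊤ := ne_top_of_le_ne_top ENNReal.ofReal_ne_top hu
  rw [Complex.norm_real, hI, Real.norm_of_nonneg ENNReal.toReal_nonneg]
  exact ⟨(ENNReal.ofReal_le_iff_le_toReal htop).1 hl, ENNReal.toReal_le_of_le_ofReal hu0 hu⟩

lemma exists_bump {V : Set (ℝ × ℝ)} (hV : IsOpen V) (h0 : (0 : ℝ × ℝ) ∈ V) :
    ∃ φ ∈ testFunctions V, ∃ r : ℝ, 0 < r ∧ r ≤ 1 ∧ (∀ z, 0 ≤ φ z) ∧ (∀ z, φ z ≤ 1) ∧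
      (∀ x y : ℝ, |x| ≤ r → |y| ≤ r → φ (x, y) = 1) ∧
      (∀ x y : ℝ, φ (x, y) ≠ 0 → |x| ≤ 1 ∧ |y| ≤ 1) := by
  obtain ⟨ε, hε, hball⟩ := Metric.isOpen_iff.1 hV 0 h0
  set R := min (ε / 2) 1 with hR
  have hR0 : 0 < R := by positivity
  let φ : ContDiffBump (0 : ℝ × ℝ) := ⟨R / 2, R, by positivity, by linarith⟩
  refine ⟨φ, ⟨φ.contDiff, φ.hasCompactSupport, ?_⟩, R / 2, by positivity, ?_, fun z => φ.nonneg,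
    fun z => φ.le_one, ?_, ?_⟩
  · rw [φ.tsupport_eq]
    refine (Metric.closedBall_subset_ball ?_).trans hball
    exact (min_le_left _ _).trans_lt (by linarith)
  · linarith [min_le_right (ε / 2) 1]
  · intro x y hx hy
    refine φ.one_of_mem_closedBall ?_
    rw [Metric.mem_closedBall, dist_zero_right, Prod.norm_def]
    exact max_le hx hy
  · intro x y h
    have hm : (x, y) ∈ Function.support φ := h
    rw [φ.support_eq, Metric.mem_ball, dist_zero_right, Prod.norm_def] at hm
    have hm' : max |x| |y| < R := hm
    have hR1 : R ≤ 1 := min_le_right _ _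
    exact ⟨by linarith [le_max_left |x| |y|], by linarith [le_max_right |x| |y|]⟩

lemma locallyIntegrable_of_box {h : ℝ × ℝ → ℝ} (hm : Measurable h) (hn : ∀ z, 0 ≤ h z)
    (hbox : ∀ R : ℝ, 0 ≤ R →
      ∫⁻ z in Icc (-R) R ×ˢ Icc (-R) R, ENNReal.ofReal (h z) < ⊤) : LocallyIntegrable h := by
  refine fun z => ⟨Metric.ball 0 (‖z‖ + 1), Metric.isOpen_ball.mem_nhds ?_, ?_⟩
  · rw [Metric.mem_ball, dist_zero_right]; linarith
  · have hsub : Metric.ball (0 : ℝ × ℝ) (‖z‖ + 1) ⊆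
        Icc (-(‖z‖ + 1)) (‖z‖ + 1) ×ˢ Icc (-(‖z‖ + 1)) (‖z‖ + 1) := by
      intro w hw
      rw [Metric.mem_ball, dist_zero_right, Prod.norm_def] at hw
      have h1 : |w.1| ≤ ‖z‖ + 1 := (le_max_left _ _).trans hw.le
      have h2 : |w.2| ≤ ‖z‖ + 1 := (le_max_right _ _).trans hw.le
      exact ⟨abs_le.1 h1, abs_le.1 h2⟩
    refine IntegrableOn.mono_set ⟨hm.aestronglyMeasurable, ?_⟩ hsub
    rw [hasFiniteIntegral_iff_ofReal (Eventually.of_forall hn)]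
    exact hbox _ (by positivity)

lemma lintegral_box_monomial_lt_top {α β R R' : ℝ} (hα : -1 < α) (hβ : -1 < β) (hR : 0 ≤ R)
    (hR' : 0 ≤ R') :
    ∫⁻ z in Icc (-R) R ×ˢ Icc (-R') R', ENNReal.ofReal (|z.1| ^ α * |z.2| ^ β) < ⊤ := by
  rw [Measure.volume_eq_prod, ← Measure.prod_restrict,
    lintegral_prod _ (by fun_prop)]
  have h : ∀ x y : ℝ, ENNReal.ofReal (|x| ^ α * |y| ^ β) =
      ENNReal.ofReal (|x| ^ α) * ENNReal.ofReal (|y| ^ β) := fun x y =>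
    ENNReal.ofReal_mul (by positivity)
  simp only [h]
  have h2 : ∀ x : ℝ, ∫⁻ y in Icc (-R') R', ENNReal.ofReal (|x| ^ α) * ENNReal.ofReal (|y| ^ β) =
      ENNReal.ofReal (|x| ^ α) * ∫⁻ y in Icc (-R') R', ENNReal.ofReal (|y| ^ β) := fun x =>
    lintegral_const_mul _ (by fun_prop)
  simp only [h2]
  rw [lintegral_mul_const _ (by fun_prop)]
  exact ENNReal.mul_lt_top (lintegral_Icc_abs_rpow_lt_top hα hR)
    (lintegral_Icc_abs_rpow_lt_top hβ hR')

/-- Allows a small power of `ψ(y)/x²` to be spent: small enough to keep `|x|` integrable, yet `ψ` to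
any positive power is still flat. -/
lemma min_one_le_rpow {u θ : ℝ} (hu : 0 ≤ u) (hθ : 0 ≤ θ) (hθ1 : θ ≤ 1) : min 1 u ≤ u ^ θ := by
  rcases le_total u 1 with h | h
  · refine (min_le_right _ _).trans ?_
    have := Real.rpow_le_rpow_of_exponent_ge' hu h hθ hθ1
    rwa [Real.rpow_one] at this
  · exact (min_le_left _ _).trans (Real.one_le_rpow h hθ)

/-- Difference of complex powers of comparable positive numbers. -/
lemma norm_cpow_sub_cpow_le {P Q σ₁ : ℝ} {s : ℂ} (hQ : 0 < Q) (hQP : Q ≤ P) (hσ₁ : -1 ≤ σ₁)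
    (hσ₁' : σ₁ ≤ 0) (h1 : σ₁ ≤ s.re) (h2 : s.re ≤ 1) :
    ‖(P : ℂ) ^ s - (Q : ℂ) ^ s‖ ≤
      (4 + 2 * ‖s‖) * (1 + P) ^ 2 * Q ^ σ₁ * min 1 ((P - Q) / Q) := by
  have hP : 0 < P := hQ.trans_le hQP
  set T := 1 + P with hT
  have hT1 : 1 ≤ T := by linarith
  have hQσ : 0 < Q ^ σ₁ := by positivity
  have hone : 1 ≤ T * Q ^ σ₁ := by
    have e1 : T ^ σ₁ ≤ Q ^ σ₁ := Real.rpow_le_rpow_of_nonpos hQ (by linarith) hσ₁'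
    have e2 : T ^ (-1 : ℝ) ≤ T ^ σ₁ := Real.rpow_le_rpow_of_exponent_le hT1 hσ₁
    rw [Real.rpow_neg_one] at e2
    calc (1 : ℝ) = T * T⁻¹ := (mul_inv_cancel₀ (by linarith)).symm
      _ ≤ T * Q ^ σ₁ := by gcongr; linarith
  have hPT : P ≤ T ^ 2 * Q ^ σ₁ := by
    calc P ≤ T * 1 := by linarith
      _ ≤ T * (T * Q ^ σ₁) := by gcongr
      _ = _ := by ring
  have hQT : Q ^ σ₁ ≤ T ^ 2 * Q ^ σ₁ := by
    have : 1 ≤ T ^ 2 := one_le_pow₀ hT1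
    nlinarith
  have hQs : Q ^ s.re ≤ 2 * T ^ 2 * Q ^ σ₁ := by
    have := rpow_le_add_of_lt hQ h1 h2
    linarith
  have hPs : P ^ s.re ≤ 2 * T ^ 2 * Q ^ σ₁ := by
    have e1 := rpow_le_add_of_lt hP h1 h2
    have e2 : P ^ σ₁ ≤ Q ^ σ₁ := Real.rpow_le_rpow_of_nonpos hQ hQP hσ₁'
    linarith
  have hn : ∀ t : ℝ, 0 < t → ∀ w : ℂ, ‖(t : ℂ) ^ w‖ = t ^ w.re := fun t ht w =>
    Complex.norm_cpow_eq_rpow_re_of_pos ht w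
  -- `b1` is the triangle inequality and `b2` the mean value inequality on `[Q, P]`; they give the
  -- two branches of the minimum.
  have b1 : ‖(P : ℂ) ^ s - (Q : ℂ) ^ s‖ ≤ 4 * T ^ 2 * Q ^ σ₁ := by
    refine (norm_sub_le _ _).trans ?_
    rw [hn P hP, hn Q hQ]
    linarith
  have hu : 0 ≤ (P - Q) / Q := div_nonneg (by linarith) hQ.le
  have b2 : ‖(P : ℂ) ^ s - (Q : ℂ) ^ s‖ ≤ 2 * ‖s‖ * T ^ 2 * Q ^ σ₁ * ((P - Q) / Q) := by
    by_cases hs : s = 0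
    · simp [hs]
    have hd : ∀ t ∈ Icc Q P, HasDerivWithinAt (fun t : ℝ => (t : ℂ) ^ s)
        (s * (t : ℂ) ^ (s - 1)) (Icc Q P) t := fun t ht =>
      (hasDerivAt_ofReal_cpow_const (hQ.trans_le ht.1).ne' hs).hasDerivWithinAt
    have hbd : ∀ t ∈ Ico Q P, ‖s * (t : ℂ) ^ (s - 1)‖ ≤ ‖s‖ * (Q ^ s.re / Q) := by
      intro t ht
      rw [norm_mul, hn t (hQ.trans_le ht.1)]
      refine mul_le_mul_of_nonneg_left ?_ (norm_nonneg _)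
      rw [Complex.sub_re, Complex.one_re, ← Real.rpow_sub_one hQ.ne']
      exact Real.rpow_le_rpow_of_nonpos hQ ht.1 (by linarith)
    have := norm_image_sub_le_of_norm_deriv_le_segment' hd hbd P (right_mem_Icc.2 hQP)
    refine this.trans ?_
    calc ‖s‖ * (Q ^ s.re / Q) * (P - Q) = ‖s‖ * Q ^ s.re * ((P - Q) / Q) := by ring
      _ ≤ ‖s‖ * (2 * T ^ 2 * Q ^ σ₁) * ((P - Q) / Q) := by gcongr
      _ = _ := by ring
  have hs0 : 0 ≤ ‖s‖ := norm_nonneg s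
  rcases min_cases 1 ((P - Q) / Q) with ⟨h, _⟩ | ⟨h, _⟩
  · rw [h]
    have : 0 ≤ 2 * ‖s‖ * T ^ 2 * Q ^ σ₁ := by positivity
    linarith
  · rw [h]
    have : 0 ≤ 4 * T ^ 2 * Q ^ σ₁ * ((P - Q) / Q) := by positivity
    linarith

lemma exp_neg_le_factorial_mul (N : ℕ) {t : ℝ} (ht : 0 < t) :
    Real.exp (-t) ≤ N.factorial * (t⁻¹) ^ N := by
  have h := Real.pow_div_factorial_le_exp t ht.le N
  rw [Real.exp_neg, inv_pow]
  have h1 : 0 < t ^ N / N.factorial := by positivity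
  calc (Real.exp t)⁻¹ ≤ (t ^ N / N.factorial)⁻¹ := inv_anti₀ h1 h
    _ = _ := by rw [inv_div]; rfl

lemma psi_rpow (k : ℕ) {y : ℝ} (hy : y ≠ 0) (θ : ℝ) :
    psi k y ^ θ = Real.exp (-(θ / y ^ (2 * k))) := by
  rw [psi_of_ne_zero k hy, ← Real.exp_mul]
  congr 1
  ring

lemma psi_rpow_le (k N : ℕ) {y θ : ℝ} (hy : y ≠ 0) (hθ : 0 < θ) :
    psi k y ^ θ ≤ N.factorial * (θ⁻¹) ^ N * |y| ^ (2 * k * N) := by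
  have hp : y ^ (2 * k) = |y| ^ (2 * k) := by rw [pow_mul, pow_mul, sq_abs]
  have h0 : 0 < |y| := abs_pos.2 hy
  rw [psi_rpow k hy, hp]
  refine (exp_neg_le_factorial_mul N (by positivity)).trans (le_of_eq ?_)
  rw [inv_div, div_eq_inv_mul, mul_pow, ← pow_mul]
  ring

/-! ### Case (C): continuation up to `-1/a` and growth at `-1/a` -/

lemma continuous_fC (a b : ℕ) : Continuous (fC a b) := by
  have := continuous_psi (b - a)
  unfold fC
  fun_prop

lemma abs_fC {a b : ℕ} (ha : 2 ≤ a) {z : ℝ × ℝ} (hx : z.1 ≠ 0) :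
    |fC a b z| = |z.1 ^ a * z.2 ^ b| * (1 + psi (b - a) z.2 / z.1 ^ 2) := by
  have h1 : z.1 ^ a = z.1 ^ (a - 2) * z.1 ^ 2 := by rw [← pow_add]; congr 1; omega
  have h2 := psi_nonneg (b - a) z.2
  have h3 : 0 < z.1 ^ 2 := by positivity
  have h4 : z.1 ^ 2 * (1 + psi (b - a) z.2 / z.1 ^ 2) = z.1 ^ 2 + psi (b - a) z.2 := by
    field_simp
  rw [fC, h1, abs_mul, abs_mul, abs_mul, abs_mul, abs_of_pos h3,
    abs_of_nonneg (by positivity : 0 ≤ z.1 ^ 2 + psi (b - a) z.2), ← h4]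
  ring

/-- The difference between the zeta function of `fC a b` and that of the monomial `x ^ a y ^ b`. -/
def zetaDiff (a b : ℕ) (φ : ℝ × ℝ → ℝ) (s : ℂ) : ℂ :=
  ∫ z : ℝ × ℝ, (absCpow (fC a b z) s - absCpow (z.1 ^ a * z.2 ^ b) s) * (φ z : ℂ)

lemma measurable_zetaDiff_integrand (a b : ℕ) {φ : ℝ × ℝ → ℝ} (hφ : Continuous φ) (s : ℂ) :
    Measurable fun z : ℝ × ℝ =>
      (absCpow (fC a b z) s - absCpow (z.1 ^ a * z.2 ^ b) s) * (φ z : ℂ) :=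
  (((measurable_absCpow s).comp (continuous_fC a b).measurable).sub
    ((measurable_absCpow s).comp (by fun_prop))).mul
    (Complex.measurable_ofReal.comp hφ.measurable)

/-- The integrand is at most a constant times `|x|^(aσ) |y|^(bσ) (ψ(y)/x²)^θ` on the support. For `σ
> -1/a` and small `θ` the `x`-power is integrable, and `ψ^θ` beats the possibly non-integrable power
of `y`. -/
lemma differentiableOn_zetaDiff {a b : ℕ} (ha : 2 ≤ a) (hab : a < b) {φ : ℝ × ℝ → ℝ}
    (hφ : Continuous φ) (hc : HasCompactSupport φ) :
    DifferentiableOn ℂ (zetaDiff a b φ) (strip (-(1 / (a : ℝ))) 1) := by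
  have ha0 : (0 : ℝ) < a := by positivity
  have ha2 : (2 : ℝ) ≤ a := by exact_mod_cast ha
  have hab' : (a : ℝ) < b := by exact_mod_cast hab
  unfold zetaDiff
  refine differentiableOn_integral_of_dominated (isOpen_strip _ _) ?_ ?_ ?_
  · intro s _
    exact (measurable_zetaDiff_integrand a b hφ s).aestronglyMeasurable
  · refine Eventually.of_forall fun z => ?_
    exact (((differentiable_absCpow _).sub (differentiable_absCpow _)).mul_const _).differentiableOn
  · intro s₀ hs₀
    obtain ⟨σ₁, h1, h2, r, hr, hball⟩ := exists_ball_re_gt (by positivity : 0 < 1 / (a : ℝ)) hs₀.1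
    have haσ : -1 < a * σ₁ := by
      have := mul_lt_mul_of_pos_left h1 ha0
      rwa [mul_neg, mul_one_div_cancel ha0.ne'] at this
    have hσ1 : -1 ≤ σ₁ := by nlinarith
    -- With this choice `α + 1 = (1 + a σ₁) / 2`, which is positive.
    set θ := (1 + a * σ₁) / 4 with hθ
    have hθ0 : 0 < θ := by rw [hθ]; linarith
    have haneg : a * σ₁ < 0 := mul_neg_of_pos_of_neg ha0 h2
    have hθ1 : θ ≤ 1 := by rw [hθ]; linarith
    set α := a * σ₁ - 2 * θ with hα
    have hα1 : -1 < α := by rw [hα, hθ]; linarith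
    set k := b - a with hk
    have hk1 : 1 ≤ k := by omega
    -- Using `b` terms of decay, `ψ ^ θ` contributes `|y| ^ (2kb)`, and `2kb ≥ b ≥ -b σ₁` makes the
    -- total exponent nonnegative.
    set e : ℝ := b * σ₁ + (2 * k * b : ℕ) with he
    have he0 : 0 ≤ e := by
      have hk' : (1 : ℝ) ≤ k := by exact_mod_cast hk1
      have hb0 : (0 : ℝ) < b := by linarith
      rw [he]; push_cast
      nlinarith [mul_le_mul_of_nonneg_left hσ1 hb0.le, mul_le_mul_of_nonneg_right hk' hb0.le]
    have hfc := continuous_fC a b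
    have hcont : Continuous fun z : ℝ × ℝ => (4 + 2 * (‖s₀‖ + r)) * (1 + |fC a b z|) ^ 2 *
        (b.factorial * (θ⁻¹) ^ b) * (1 + |z.2|) ^ e * |φ z| := by
      refine Continuous.mul (Continuous.mul (by fun_prop) ?_) hφ.abs
      exact Continuous.rpow_const (by fun_prop) fun _ => Or.inr he0
    have hloc : LocallyIntegrable fun z : ℝ × ℝ => |z.1| ^ α := by
      refine locallyIntegrable_of_box (by fun_prop) (fun z => by positivity) fun R hR => ?_
      have := lintegral_box_monomial_lt_top hα1 (β := 0) (by norm_num) hR hR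
      simpa using this
    refine ⟨r, hr, _, hloc.integrable_smul_left_of_hasCompactSupport hcont hc.abs.mul_left, ?_⟩
    filter_upwards [ae_fst_ne_zero, ae_snd_ne_zero] with z hx hy s hs hsW
    set Q := |z.1 ^ a * z.2 ^ b| with hQ
    set P := |fC a b z| with hP
    have hQ0 : 0 < Q := abs_pos.2 (mul_ne_zero (pow_ne_zero _ hx) (pow_ne_zero _ hy))
    have hPQ : P = Q * (1 + psi k z.2 / z.1 ^ 2) := abs_fC ha hx
    have hψ := psi_nonneg k z.2
    have hu : 0 ≤ psi k z.2 / z.1 ^ 2 := by positivity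
    have hQP : Q ≤ P := by rw [hPQ]; nlinarith
    have hP0 : 0 < P := hQ0.trans_le hQP
    have hdiv : (P - Q) / Q = psi k z.2 / z.1 ^ 2 := by
      rw [hPQ]; field_simp; ring
    have key := norm_cpow_sub_cpow_le (s := s) hQ0 hQP hσ1 h2.le (hball s hs).le hsW.2.le
    rw [hdiv] at key
    have hsn : ‖s‖ ≤ ‖s₀‖ + r := by
      rw [Metric.mem_ball, dist_eq_norm] at hs
      linarith [norm_le_norm_add_norm_sub' s s₀]
    have hX : 0 < |z.1| := abs_pos.2 hx
    have hY : 0 < |z.2| := abs_pos.2 hy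
    have e1 : Q ^ σ₁ = |z.1| ^ (a * σ₁) * |z.2| ^ (b * σ₁) := by
      rw [hQ, abs_mul, abs_pow, abs_pow, Real.mul_rpow (by positivity) (by positivity),
        ← Real.rpow_natCast_mul hX.le, ← Real.rpow_natCast_mul hY.le]
    have e2 : (psi k z.2 / z.1 ^ 2) ^ θ = psi k z.2 ^ θ * |z.1| ^ (-(2 * θ)) := by
      rw [Real.div_rpow hψ (by positivity), ← sq_abs z.1, ← Real.rpow_natCast_mul hX.le,
        Real.rpow_neg hX.le, div_eq_mul_inv]
      norm_num
    have e3 : |z.2| ^ (b * σ₁) * psi k z.2 ^ θ ≤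
        b.factorial * (θ⁻¹) ^ b * (1 + |z.2|) ^ e := by
      calc |z.2| ^ (b * σ₁) * psi k z.2 ^ θ
          ≤ |z.2| ^ (b * σ₁) * (b.factorial * (θ⁻¹) ^ b * |z.2| ^ (2 * k * b)) := by
            gcongr; exact psi_rpow_le k b hy hθ0
        _ = b.factorial * (θ⁻¹) ^ b * |z.2| ^ e := by
            rw [he, Real.rpow_add hY, Real.rpow_natCast]; ring
        _ ≤ _ := by gcongr; linarith
    have e4 : |z.1| ^ α = |z.1| ^ (a * σ₁) * |z.1| ^ (-(2 * θ)) := by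
      rw [hα, sub_eq_add_neg, Real.rpow_add hX]
    have hmin := min_one_le_rpow hu hθ0.le hθ1
    have hf0 : fC a b z ≠ 0 := abs_pos.1 hP0
    have hm0 : z.1 ^ a * z.2 ^ b ≠ 0 := abs_pos.1 hQ0
    rw [norm_mul, Complex.norm_real, Real.norm_eq_abs, absCpow, absCpow, if_neg hf0, if_neg hm0]
    calc ‖(P : ℂ) ^ s - (Q : ℂ) ^ s‖ * |φ z|
        ≤ ((4 + 2 * (‖s₀‖ + r)) * (1 + P) ^ 2 * Q ^ σ₁ * (psi k z.2 / z.1 ^ 2) ^ θ) * |φ z| := by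
          refine mul_le_mul_of_nonneg_right (key.trans ?_) (abs_nonneg _)
          gcongr
      _ = (4 + 2 * (‖s₀‖ + r)) * (1 + P) ^ 2 * |φ z| * |z.1| ^ α *
            (|z.2| ^ (b * σ₁) * psi k z.2 ^ θ) := by
          rw [e1, e2, e4]; ring
      _ ≤ (4 + 2 * (‖s₀‖ + r)) * (1 + P) ^ 2 * |φ z| * |z.1| ^ α *
            (b.factorial * (θ⁻¹) ^ b * (1 + |z.2|) ^ e) := by
          gcongr
      _ = _ := by rw [smul_eq_mul]; ring

lemma zeta_fC_eq (a b : ℕ) {φ : ℝ × ℝ → ℝ} (hφ : Continuous φ) (hc : HasCompactSupport φ) {s : ℂ}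
    (hs : 0 < s.re) : zeta (fC a b) φ s =
      (∫ z : ℝ × ℝ, absCpow (z.1 ^ a * z.2 ^ b) s * (φ z : ℂ)) + zetaDiff a b φ s := by
  have h1 := integrable_of_re_pos (continuous_fC a b) hφ hc hs
  have h2 := integrable_of_re_pos (f := fun z : ℝ × ℝ => z.1 ^ a * z.2 ^ b) (by fun_prop) hφ hc hs
  rw [zeta_eq hs, zetaDiff]
  simp only [sub_mul]
  rw [integral_sub h1 h2]
  ring

lemma hasMeromorphicContinuation_fC {a b : ℕ} (ha : 2 ≤ a) (hab : a < b) {φ : ℝ × ℝ → ℝ}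
    (hφ : ContDiff ℝ ∞ φ) (hc : HasCompactSupport φ) :
    HasMeromorphicContinuation (fC a b) φ (1 / a) := by
  obtain ⟨M, hM, hM'⟩ := exists_meromorphic_monomial (a := a) (b := b) (by omega) (by omega) hφ hc
  refine hasMeromorphicContinuation_of_strip (continuous_fC a b) hφ.continuous hc
    (G := fun s => M s + zetaDiff a b φ s) ?_ fun s hs => ?_
  · intro s hs
    refine (hM s ?_).add ((differentiableOn_zetaDiff ha hab hφ.continuous hc).analyticAt
      ((isOpen_strip _ _).mem_nhds hs)).meromorphicAt
    have : (1 : ℝ) / a ≤ 1 := by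
      rw [div_le_one (by positivity)]; exact_mod_cast (by omega : 1 ≤ a)
    have h1 := hs.1
    change -1 < s.re
    linarith
  · rw [hM' s hs.1, zeta_fC_eq a b hφ.continuous hc hs.1]

lemma abs_monomial_rpow (a b : ℕ) (x y s : ℝ) :
    |x ^ a * y ^ b| ^ s = |x| ^ (a * s) * |y| ^ (b * s) := by
  rw [abs_mul, abs_pow, abs_pow, Real.mul_rpow (by positivity) (by positivity),
    ← Real.rpow_natCast_mul (abs_nonneg x), ← Real.rpow_natCast_mul (abs_nonneg y)]

lemma one_sub_rpow_le_min {u s : ℝ} (hu : 0 ≤ u) (hs : -1 ≤ s) : 1 - (1 + u) ^ s ≤ min 1 u := by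
  have h1 : 0 < 1 + u := by linarith
  refine le_min ?_ ?_
  · linarith [Real.rpow_nonneg h1.le s]
  · have h2 : (1 + u) ^ (-1 : ℝ) ≤ (1 + u) ^ s :=
      Real.rpow_le_rpow_of_exponent_le (by linarith) hs
    rw [Real.rpow_neg_one] at h2
    have h3 : 1 - u ≤ (1 + u)⁻¹ := by
      rw [← one_div, le_div_iff₀ h1]
      nlinarith
    linarith

/-- The (nonnegative) difference `|x ^ a y ^ b| ^ s - |fC a b| ^ s` for real negative `s`. -/
def gap (a b : ℕ) (s : ℝ) (z : ℝ × ℝ) : ℝ := |z.1 ^ a * z.2 ^ b| ^ s - |fC a b z| ^ s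

lemma gap_eq {a b : ℕ} (ha : 2 ≤ a) {s : ℝ} {z : ℝ × ℝ} (hx : z.1 ≠ 0) :
    gap a b s z = |z.1| ^ (a * s) * |z.2| ^ (b * s) *
      (1 - (1 + psi (b - a) z.2 / z.1 ^ 2) ^ s) := by
  have h := psi_nonneg (b - a) z.2
  rw [gap, abs_fC ha hx, Real.mul_rpow (abs_nonneg _) (by positivity), abs_monomial_rpow]
  ring

lemma gap_nonneg {a b : ℕ} (ha : 2 ≤ a) {s : ℝ} (hs : s ≤ 0) {z : ℝ × ℝ} (hx : z.1 ≠ 0) :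
    0 ≤ gap a b s z := by
  have h := psi_nonneg (b - a) z.2
  rw [gap_eq ha hx]
  have : (1 + psi (b - a) z.2 / z.1 ^ 2) ^ s ≤ 1 := by
    refine Real.rpow_le_one_of_one_le_of_nonpos ?_ hs
    have : 0 ≤ psi (b - a) z.2 / z.1 ^ 2 := by positivity
    linarith
  have h2 : 0 ≤ 1 - (1 + psi (b - a) z.2 / z.1 ^ 2) ^ s := by linarith
  positivity

lemma zetaDiff_ofReal (a b : ℕ) (φ : ℝ × ℝ → ℝ) {s : ℝ} (hs : s ≠ 0) :
    ‖zetaDiff a b φ (s : ℂ)‖ = ‖((∫ z, gap a b s z * φ z : ℝ) : ℂ)‖ := by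
  have : zetaDiff a b φ (s : ℂ) = -((∫ z, gap a b s z * φ z : ℝ) : ℂ) := by
    rw [zetaDiff, ← integral_complex_ofReal, ← integral_neg]
    congr 1
    funext z
    rw [absCpow_ofReal hs, absCpow_ofReal hs, gap]
    push_cast
    ring
  rw [this, norm_neg]

/-- With `η ^ (2k) = d`, the function `ψ^(d/2) = exp(-(η/|y|)^(2k)/2)` is a cutoff at scale `η`. The
product on the right is `min ((|y|/η)^n, 1)` with `n = 2kN`, shaped for `lintegral_rpow_mul_min_le`.
-/
lemma psi_rpow_le_min {k N : ℕ} {y d η : ℝ} (hy : y ≠ 0) (hd : 0 < d) (hη : 0 < η)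
    (hηd : η ^ (2 * k) = d) :
    psi k y ^ (d / 2) ≤ N.factorial * 2 ^ N * ((|y| / η) ^ (2 * k * N) *
      min 1 ((η / |y|) ^ (2 * k * N))) := by
  have hY : 0 < |y| := abs_pos.2 hy
  have h1 : psi k y ^ (d / 2) ≤ 1 := by
    rw [psi_rpow k hy]
    refine Real.exp_le_one_iff.2 ?_
    have : 0 < y ^ (2 * k) := by rw [pow_mul]; positivity
    have : 0 < d / 2 / y ^ (2 * k) := by positivity
    linarith
  have h2 := psi_rpow_le k N hy (half_pos hd)
  have h3 : ((N.factorial : ℝ)) * ((d / 2)⁻¹) ^ N * |y| ^ (2 * k * N) =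
      N.factorial * 2 ^ N * (|y| / η) ^ (2 * k * N) := by
    rw [div_pow, pow_mul η, hηd, inv_div, div_pow]; ring
  rw [h3] at h2
  have hM : (1 : ℝ) ≤ N.factorial * 2 ^ N := by
    have e1 : (1 : ℝ) ≤ N.factorial := by exact_mod_cast N.factorial_pos
    have e2 : (1 : ℝ) ≤ 2 ^ N := one_le_pow₀ (by norm_num)
    nlinarith
  have hq : (|y| / η) ^ (2 * k * N) * (η / |y|) ^ (2 * k * N) = 1 := by
    rw [← mul_pow, div_mul_div_comm, mul_comm η, div_self (by positivity), one_pow]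
  rcases min_cases 1 ((η / |y|) ^ (2 * k * N)) with ⟨h, _⟩ | ⟨h, _⟩
  · rw [h, mul_one]; exact h2
  · rw [h, hq, mul_one]; linarith

/-- The cutoff estimate is applied twice: in `x` at scale `√ψ(y)`, giving `ψ(y)^(d/2)/d`, then in
`y` at scale `η`. The hypothesis `b s + 1 < 0` makes the tail in `y` converge. -/
lemma lintegral_gap_le {a b : ℕ} (ha : 2 ≤ a) (hab : a < b) {φ : ℝ × ℝ → ℝ}
    (h1 : ∀ z, φ z ≤ 1) {d η s : ℝ} (hd : 0 < d) (hd1 : d < 1) (hs : s = 1 / a * (d - 1))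
    (hη : 0 < η) (hηd : η ^ (2 * (b - a)) = d) (hbs : b * s + 1 < 0) :
    ∫⁻ z, ENNReal.ofReal (gap a b s z * φ z) ≤
      ENNReal.ofReal (8 * (b.factorial * 2 ^ b) * d⁻¹ * η ^ (b * s + 1) *
        (1 + 1 / (-(b * s + 1)))) := by
  have ha0 : (0 : ℝ) < a := by positivity
  have has : a * s = d - 1 := by rw [hs]; field_simp
  have ha2 : (2 : ℝ) ≤ a := by exact_mod_cast ha
  have hs0 : s ≤ 0 := by nlinarith
  have hs1 : -1 ≤ s := by nlinarith
  set k := b - a with hk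
  have hk0 : k ≠ 0 := by omega
  set M : ℝ := b.factorial * 2 ^ b with hM
  have hM0 : 0 < M := by positivity
  have hψm : Measurable (psi k) := (continuous_psi k).measurable
  set n := 2 * k * b with hn
  have hnb : (b : ℝ) ≤ n := by
    have : b ≤ n := by rw [hn]; nlinarith [Nat.pos_of_ne_zero hk0]
    exact_mod_cast this
  have hb0 : (0 : ℝ) ≤ b := b.cast_nonneg
  have hα0 : 0 ≤ b * s + n := by nlinarith
  calc ∫⁻ z, ENNReal.ofReal (gap a b s z * φ z)
      ≤ ∫⁻ z : ℝ × ℝ, ENNReal.ofReal (|z.2| ^ (b * s)) * ENNReal.ofReal (|z.1| ^ (d - 1) *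
          min 1 ((√(psi k z.2) / |z.1|) ^ (2 : ℝ))) := by
        refine lintegral_mono_ae ?_
        filter_upwards [ae_fst_ne_zero] with z hx
        rw [← ENNReal.ofReal_mul (by positivity)]
        refine ENNReal.ofReal_le_ofReal ?_
        have hu : (√(psi k z.2) / |z.1|) ^ (2 : ℝ) = psi k z.2 / z.1 ^ 2 := by
          rw [Real.rpow_two, div_pow, Real.sq_sqrt (psi_nonneg _ _), sq_abs]
        have hu0 : 0 ≤ psi k z.2 / z.1 ^ 2 := div_nonneg (psi_nonneg _ _) (sq_nonneg _)
        calc gap a b s z * φ z ≤ gap a b s z :=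
              mul_le_of_le_one_right (gap_nonneg ha hs0 hx) (h1 z)
          _ ≤ |z.1| ^ (a * s) * |z.2| ^ (b * s) * min 1 (psi k z.2 / z.1 ^ 2) := by
              rw [gap_eq ha hx]
              gcongr
              exact one_sub_rpow_le_min hu0 hs1
          _ = _ := by rw [hu, has]; ring
    _ = ∫⁻ y : ℝ, ∫⁻ x : ℝ, ENNReal.ofReal (|y| ^ (b * s)) * ENNReal.ofReal (|x| ^ (d - 1) *
          min 1 ((√(psi k y) / |x|) ^ (2 : ℝ))) := by
        rw [Measure.volume_eq_prod, lintegral_prod_symm' _ (by fun_prop)]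
    _ ≤ ∫⁻ y : ℝ, ENNReal.ofReal (4 * M * d⁻¹ * (η⁻¹) ^ n) *
          ENNReal.ofReal (|y| ^ (b * s + n) * min 1 ((η / |y|) ^ (n : ℝ))) := by
        refine lintegral_mono_ae ?_
        filter_upwards [Measure.ae_ne volume (0 : ℝ)] with y hy
        have hY : 0 < |y| := abs_pos.2 hy
        rw [lintegral_const_mul _ (by fun_prop)]
        have hε : 0 < √(psi k y) := Real.sqrt_pos.2 (psi_pos k hy)
        calc _ ≤ ENNReal.ofReal (|y| ^ (b * s)) * ENNReal.ofReal (2 * √(psi k y) ^ (d - 1 + 1) *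
                  (1 / (d - 1 + 1) + 1 / (2 - (d - 1) - 1))) := by
                gcongr
                exact lintegral_rpow_mul_min_le (by linarith) (by linarith) hε
          _ ≤ _ := by
                rw [← ENNReal.ofReal_mul (by positivity), ← ENNReal.ofReal_mul (by positivity)]
                refine ENNReal.ofReal_le_ofReal ?_
                have e1 : √(psi k y) ^ (d - 1 + 1) = psi k y ^ (d / 2) := by
                  rw [Real.sqrt_eq_rpow, ← Real.rpow_mul (psi_nonneg _ _)]
                  congr 1; ring
                have e2 : 1 / (d - 1 + 1) + 1 / (2 - (d - 1) - 1) ≤ 2 * d⁻¹ := by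
                  have : 1 / (2 - (d - 1) - 1) ≤ d⁻¹ := by
                    rw [← one_div]
                    exact one_div_le_one_div_of_le hd (by linarith)
                  have e3 : 1 / (d - 1 + 1) = d⁻¹ := by rw [sub_add_cancel, one_div]
                  linarith
                have e4 := psi_rpow_le_min (N := b) hy hd hη hηd
                rw [e1]
                have hψ := psi_nonneg k y
                have e5 : 0 ≤ 1 / (d - 1 + 1) + 1 / (2 - (d - 1) - 1) :=
                  add_nonneg (one_div_nonneg.2 (by linarith)) (one_div_nonneg.2 (by linarith))
                calc |y| ^ (b * s) * (2 * psi k y ^ (d / 2) *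
                      (1 / (d - 1 + 1) + 1 / (2 - (d - 1) - 1)))
                    ≤ |y| ^ (b * s) * (2 * (M * ((|y| / η) ^ n * min 1 ((η / |y|) ^ n))) *
                      (2 * d⁻¹)) := by
                      gcongr
                  _ = _ := by
                      rw [Real.rpow_add hY, Real.rpow_natCast, Real.rpow_natCast, div_pow |y| η,
                        inv_pow]
                      ring
    _ ≤ ENNReal.ofReal (4 * M * d⁻¹ * (η⁻¹) ^ n) * ENNReal.ofReal (2 * η ^ (b * s + n + 1) *
          (1 / (b * s + n + 1) + 1 / (n - (b * s + n) - 1))) := by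
        rw [lintegral_const_mul _ (by fun_prop)]
        gcongr
        exact lintegral_rpow_mul_min_le (by linarith) (by linarith) hη
    _ ≤ _ := by
        rw [← ENNReal.ofReal_mul (by positivity)]
        refine ENNReal.ofReal_le_ofReal ?_
        have e1 : η ^ (b * s + n + 1) = η ^ n * η ^ (b * s + 1) := by
          rw [← Real.rpow_natCast η n, ← Real.rpow_add hη]; congr 1; ring
        have e2 : (η⁻¹) ^ n * η ^ n = 1 := by
          rw [← mul_pow, inv_mul_cancel₀ hη.ne', one_pow]
        have e3 : 1 / (b * s + n + 1) ≤ 1 := by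
          rw [div_le_one (by linarith)]; linarith
        have e4 : (n : ℝ) - (b * s + n) - 1 = -(b * s + 1) := by ring
        rw [e1, e4]
        have h5 : 0 < η ^ (b * s + 1) := by positivity
        calc 4 * M * d⁻¹ * (η⁻¹) ^ n * (2 * (η ^ n * η ^ (b * s + 1)) *
              (1 / (b * s + n + 1) + 1 / (-(b * s + 1))))
            = ((η⁻¹) ^ n * η ^ n) * (8 * M * d⁻¹ * η ^ (b * s + 1)) *
              (1 / (b * s + n + 1) + 1 / (-(b * s + 1))) := by ring
          _ ≤ _ := by
              rw [e2, one_mul]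
              gcongr

lemma psi_ge_exp {k : ℕ} {y d η : ℝ} (hη : 0 < η) (hηd : η ^ (2 * k) = d)
    (hy : η ≤ |y|) : Real.exp (-(1 / (2 * d))) ^ 2 ≤ psi k y := by
  have h1 : psi k η ≤ psi k y := psi_mono k (by rwa [abs_of_pos hη])
  refine le_trans (le_of_eq ?_) h1
  rw [psi_of_ne_zero k hη.ne', hηd, ← Real.exp_nat_mul]
  congr 1
  push_cast
  rw [one_div, mul_inv]
  ring

lemma le_lintegral_gap {a b : ℕ} (ha : 2 ≤ a) {φ : ℝ × ℝ → ℝ} {r : ℝ}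
    (h1 : ∀ x y : ℝ, |x| ≤ r → |y| ≤ r → φ (x, y) = 1)
    {d η s : ℝ} (hd : 0 < d) (hd1 : d < 1 / 2) (hs : s = 1 / a * (d - 1))
    (hη : 0 < η) (hηd : η ^ (2 * (b - a)) = d) (hηr : 2 * η ≤ r)
    (hdr : Real.exp (-(1 / (2 * d))) ≤ r) :
    ENNReal.ofReal ((1 / 2) ^ b * (1 - 2 ^ (-(1 / (2 * a : ℝ)))) * Real.exp (-(1 / 2)) * d⁻¹ *
      η ^ (b * s + 1)) ≤ ∫⁻ z, ENNReal.ofReal (gap a b s z * φ z) := by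
  have ha0 : (0 : ℝ) < a := by positivity
  have has : a * s = d - 1 := by rw [hs]; field_simp
  have ha2 : (2 : ℝ) ≤ a := by exact_mod_cast ha
  have hs0 : s ≤ 0 := by nlinarith
  have hs1 : -1 ≤ s := by nlinarith
  have hb0 : (0 : ℝ) ≤ b := b.cast_nonneg
  set k := b - a with hk
  set e := Real.exp (-(1 / (2 * d))) with he
  have he0 : 0 < e := Real.exp_pos _
  set c₁ : ℝ := 1 - 2 ^ (-(1 / (2 * a : ℝ))) with hc₁
  have hc₁0 : 0 ≤ c₁ := by
    have : (2 : ℝ) ^ (-(1 / (2 * a : ℝ))) ≤ 1 :=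
      Real.rpow_le_one_of_one_le_of_nonpos (by norm_num)
        (by rw [neg_nonpos]; positivity)
    rw [hc₁]; linarith
  -- For `y ≥ η` one has `ψ(y) ≥ ψ(η) = e²`, so `x ≤ e` gives `ψ(y)/x² ≥ 1` and the gap factor stays
  -- at least `c₁`. Since `e ^ d = exp(-1/2)`, the `x`-integral keeps the full order `d⁻¹`.
  have hbox := le_lintegral_box (g := fun z => ENNReal.ofReal (gap a b s z * φ z))
    (S := Ioc 0 e) (T := Icc η (2 * η)) measurableSet_Ioc measurableSet_Icc
    (u := fun x => ENNReal.ofReal ((1 / 2) ^ b * c₁ * η ^ (b * s)) * ENNReal.ofReal (x ^ (d - 1)))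
    (by fun_prop) ?_
  · refine le_trans (le_of_eq ?_) hbox
    have hed : e ^ d = Real.exp (-(1 / 2)) := by
      rw [he, ← Real.exp_mul]; congr 1; field_simp
    rw [lintegral_const_mul _ (by fun_prop), lintegral_Ioc_zero_rpow (by linarith) he0.le,
      Real.volume_Icc, sub_add_cancel, hed, ← ENNReal.ofReal_mul (by positivity),
      ← ENNReal.ofReal_mul (by positivity), Real.rpow_add_one hη.ne']
    congr 1
    ring
  · intro x hx y hy
    rw [← ENNReal.ofReal_mul (by positivity)]
    refine ENNReal.ofReal_le_ofReal ?_
    have hx0 : 0 < x := hx.1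
    have hy0 : 0 < y := hη.trans_le hy.1
    rw [h1 x y (by rw [abs_of_pos hx0]; linarith [hx.2])
      (by rw [abs_of_pos hy0]; linarith [hy.2]), mul_one, gap_eq ha hx0.ne']
    simp only [abs_of_pos hx0, abs_of_pos hy0, has]
    have hψ : e ^ 2 ≤ psi k y := psi_ge_exp hη hηd (by rw [abs_of_pos hy0]; exact hy.1)
    have hu : 1 ≤ psi k y / x ^ 2 := by
      rw [one_le_div (by positivity)]
      exact (pow_le_pow_left₀ hx0.le hx.2 2).trans hψ
    have hc : c₁ ≤ 1 - (1 + psi k y / x ^ 2) ^ s := by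
      have e1 : (1 + psi k y / x ^ 2) ^ s ≤ 2 ^ s :=
        Real.rpow_le_rpow_of_nonpos (by norm_num) (by linarith) hs0
      have e2 : (2 : ℝ) ^ s ≤ 2 ^ (-(1 / (2 * a : ℝ))) := by
        refine Real.rpow_le_rpow_of_exponent_le (by norm_num) ?_
        rw [hs]
        have : -(1 / (2 * a : ℝ)) = 1 / a * (-(1 / 2)) := by field_simp
        rw [this]
        refine mul_le_mul_of_nonneg_left (by linarith) (by positivity)
      rw [hc₁]; linarith
    have hyb : (1 / 2) ^ b * η ^ (b * s) ≤ y ^ (b * s) := by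
      have e1 : (2 * η) ^ (b * s) ≤ y ^ (b * s) :=
        Real.rpow_le_rpow_of_nonpos hy0 hy.2 (by nlinarith)
      have e2 : ((1 / 2) ^ b : ℝ) ≤ 2 ^ (b * s) := by
        rw [one_div, inv_pow, ← Real.rpow_natCast, ← Real.rpow_neg (by norm_num)]
        exact Real.rpow_le_rpow_of_exponent_le (by norm_num) (by nlinarith)
      rw [Real.mul_rpow (by norm_num) hη.le] at e1
      refine le_trans ?_ e1
      gcongr
    have hxp : 0 < x ^ (d - 1) := by positivity
    calc (1 / 2) ^ b * c₁ * η ^ (b * s) * x ^ (d - 1)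
        = x ^ (d - 1) * ((1 / 2) ^ b * η ^ (b * s)) * c₁ := by ring
      _ ≤ x ^ (d - 1) * y ^ (b * s) * (1 - (1 + psi k y / x ^ 2) ^ s) := by gcongr

lemma eventually_small (c : ℝ) (hc : 0 < c) : ∀ᶠ d : ℝ in 𝓝[>] 0, 0 < d ∧ d < c := by
  filter_upwards [Ioo_mem_nhdsGT hc] with d hd using hd

lemma eventually_rpow_le {e c : ℝ} (he : 0 < e) (hc : 0 < c) :
    ∀ᶠ d : ℝ in 𝓝[>] 0, d ^ e ≤ c := by
  have h := (Real.continuousAt_rpow_const 0 e (Or.inr he.le)).tendsto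
  rw [Real.zero_rpow he.ne'] at h
  exact (h.mono_left nhdsWithin_le_nhds).eventually (ge_mem_nhds hc)

lemma zetaDiff_growth {a b : ℕ} (ha : 2 ≤ a) (hab : a < b) {φ : ℝ × ℝ → ℝ} (hφ : Continuous φ)
    (h0 : ∀ z, 0 ≤ φ z) (h1 : ∀ z, φ z ≤ 1) {r : ℝ} (hr : 0 < r)
    (hφ1 : ∀ x y : ℝ, |x| ≤ r → |y| ≤ r → φ (x, y) = 1) :
    ∃ c C : ℝ, 0 < c ∧ ∀ᶠ d : ℝ in 𝓝[>] 0,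
      c * d ^ (-1 - 1 / (2 * a : ℝ)) ≤ ‖zetaDiff a b φ ((1 / a * (d - 1) : ℝ) : ℂ)‖ ∧
      ‖zetaDiff a b φ ((1 / a * (d - 1) : ℝ) : ℂ)‖ ≤ C * d ^ (-1 - 1 / (2 * a : ℝ)) := by
  have ha0 : (0 : ℝ) < a := by positivity
  have hab' : (a : ℝ) < b := by exact_mod_cast hab
  have hba : (0 : ℝ) < b - a := by linarith
  have hb0 : (0 : ℝ) < b := by linarith
  -- `K d` is the excess of the exponent of `d` in `d⁻¹ η ^ (b s + 1)` over its limit `-1 - 1/(2a)`.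
  set K : ℝ := b / a / (2 * (b - a)) with hK
  have hK0 : 0 < K := by positivity
  set c₁ : ℝ := (1 / 2) ^ b * (1 - 2 ^ (-(1 / (2 * a : ℝ)))) * Real.exp (-(1 / 2)) with hc₁
  have hc₁0 : 0 < c₁ := by
    have : (2 : ℝ) ^ (-(1 / (2 * a : ℝ))) < 1 :=
      Real.rpow_lt_one_of_one_lt_of_neg (by norm_num) (by rw [neg_lt_zero]; positivity)
    have : 0 < 1 - (2 : ℝ) ^ (-(1 / (2 * a : ℝ))) := by linarith
    positivity
  -- For `d < d₀`, `b s + 1 ≤ -(b - a)/(2a)`, which bounds the factor `1 / (-(b s + 1))` of the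
  -- upper estimate.
  set d₀ : ℝ := (b - a) / (2 * b) with hd₀
  have hd₀0 : 0 < d₀ := by positivity
  set A : ℝ := 1 + 1 / ((b - a) / (2 * a)) with hA
  refine ⟨c₁ * Real.exp (-K), 8 * (b.factorial * 2 ^ b) * A, by positivity, ?_⟩
  filter_upwards [eventually_small (1 / 2) (by norm_num), eventually_small d₀ hd₀0,
    eventually_small (r / 2) (by positivity),
    eventually_rpow_le (e := 1 / (2 * (b - a) : ℕ)) (c := r / 2)
      (by have : 0 < 2 * (b - a) := by omega
          positivity) (by positivity)] with d hd hdd₀ hdr hηr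
  have hd0 := hd.1
  set η : ℝ := d ^ (1 / (2 * (b - a) : ℕ) : ℝ) with hη
  have hη0 : 0 < η := by positivity
  have hp0 : 2 * (b - a) ≠ 0 := by omega
  have hηd : η ^ (2 * (b - a)) = d := by
    rw [hη, one_div, Real.rpow_inv_natCast_pow hd0.le hp0]
  set s : ℝ := 1 / a * (d - 1) with hs
  have hbs : b * s + 1 ≤ -((b - a) / (2 * a)) := by
    have h3 : d * (2 * b) < b - a := by
      have := hdd₀.2
      rwa [hd₀, lt_div_iff₀ (by positivity)] at this
    have h4 : b * s + 1 + (b - a) / (2 * a) = (2 * b * d - (b - a)) / (2 * a) := by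
      rw [hs]; field_simp; ring
    have h5 : (2 * b * d - (b - a)) / (2 * a) ≤ 0 :=
      div_nonpos_of_nonpos_of_nonneg (by linarith) (by positivity)
    linarith
  have hbs' : 0 < (b - a : ℝ) / (2 * a) := by positivity
  have hs0 : s ≠ 0 := by
    intro h; rw [h] at hbs; linarith
  have hs0' : s ≤ 0 := by
    rw [hs]
    exact mul_nonpos_of_nonneg_of_nonpos (by positivity) (by linarith [hd.2])
  have hηpow : d⁻¹ * η ^ (b * s + 1) = d ^ (-1 - 1 / (2 * a : ℝ)) * d ^ (K * d) := by
    rw [hη, ← Real.rpow_mul hd0.le, ← Real.rpow_neg_one, ← Real.rpow_add hd0,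
      ← Real.rpow_add hd0]
    congr 1
    have : ((2 * (b - a) : ℕ) : ℝ) = 2 * (b - a) := by
      push_cast [Nat.cast_sub hab.le]; ring
    rw [this, hs, hK]
    field_simp
    ring
  have hdα : 0 < d ^ (-1 - 1 / (2 * a : ℝ)) := by positivity
  have hdK : Real.exp (-K) ≤ d ^ (K * d) := exp_neg_le_rpow_self_mul hd0 hK0.le
  have hdK1 : d ^ (K * d) ≤ 1 :=
    Real.rpow_le_one hd0.le (by linarith [hd.2]) (by positivity)
  have hexp : Real.exp (-(1 / (2 * d))) ≤ r := by
    have := exp_neg_le_factorial_mul 1 (t := 1 / (2 * d)) (by positivity)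
    simp only [Nat.factorial_one, Nat.cast_one, pow_one, one_mul, one_div, inv_inv] at this
    rw [one_div]
    linarith [hdr.2]
  have hup := lintegral_gap_le ha hab h1 hd0 (by linarith [hd.2]) hs hη0 hηd (by linarith)
  have hlow := le_lintegral_gap ha hφ1 hd0 hd.2 hs hη0 hηd (by linarith) hexp
  have hm : AEStronglyMeasurable (fun z => gap a b s z * φ z) := by
    have := (continuous_fC a b).measurable
    unfold gap
    exact Measurable.aestronglyMeasurable (by fun_prop)
  have hn : ∀ᵐ z, 0 ≤ gap a b s z * φ z := by
    filter_upwards [ae_fst_ne_zero] with z hz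
    exact mul_nonneg (gap_nonneg ha hs0' hz) (h0 z)
  have hpos : 0 ≤ 1 + 1 / (-(b * s + 1)) := by
    have : 0 < -(b * s + 1) := by linarith
    positivity
  obtain ⟨k1, k2⟩ := abs_integral_bounds hm hn hlow hup (by positivity)
  rw [zetaDiff_ofReal a b φ hs0]
  constructor
  · refine le_trans ?_ k1
    calc c₁ * Real.exp (-K) * d ^ (-1 - 1 / (2 * a : ℝ))
        ≤ c₁ * d ^ (K * d) * d ^ (-1 - 1 / (2 * a : ℝ)) := by gcongr
      _ = c₁ * (d⁻¹ * η ^ (b * s + 1)) := by rw [hηpow]; ring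
      _ = _ := by rw [hc₁]; ring
  · refine k2.trans ?_
    have hA' : 1 + 1 / (-(b * s + 1)) ≤ A := by
      rw [hA]
      gcongr
      linarith
    calc 8 * (b.factorial * 2 ^ b) * d⁻¹ * η ^ (b * s + 1) * (1 + 1 / (-(b * s + 1)))
        = 8 * (b.factorial * 2 ^ b) * (1 + 1 / (-(b * s + 1))) * (d⁻¹ * η ^ (b * s + 1)) := by ring
      _ ≤ 8 * (b.factorial * 2 ^ b) * A * (d ^ (-1 - 1 / (2 * a : ℝ)) * 1) := by
          rw [hηpow]
          gcongr
      _ = _ := by ring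

lemma not_hasMeromorphicContinuation_fC {a b : ℕ} (ha : 2 ≤ a) (hab : a < b) {φ : ℝ × ℝ → ℝ}
    (hφ : ContDiff ℝ ∞ φ) (hc : HasCompactSupport φ)
    (h0 : ∀ z, 0 ≤ φ z) (h1 : ∀ z, φ z ≤ 1) {r : ℝ} (hr : 0 < r)
    (hφ1 : ∀ x y : ℝ, |x| ≤ r → |y| ≤ r → φ (x, y) = 1) {ρ : ℝ} (hρ : 1 / (a : ℝ) < ρ) :
    ¬ HasMeromorphicContinuation (fC a b) φ ρ := by
  rintro ⟨F, hF, hFz⟩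
  have ha0 : (0 : ℝ) < a := by positivity
  have ha2 : (2 : ℝ) ≤ a := by exact_mod_cast ha
  obtain ⟨M, hM, hM'⟩ := exists_meromorphic_monomial (a := a) (b := b) (by omega) (by omega) hφ hc
  obtain ⟨c, C, hc0, hb⟩ := zetaDiff_growth ha hab hφ.continuous h0 h1 hr hφ1
  have h1a : (1 : ℝ) / a < 1 := by rw [div_lt_one ha0]; linarith
  -- The monomial part is subtracted, so the obstruction is applied to `zetaDiff`. The minimum with
  -- `1` is needed as `M` is meromorphic only on `Re s > -1`; it still exceeds `1/a` because `a ≥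
  -- 2`.
  refine no_meromorphic_of_growth (σ := 1 / a) (ρ := min ρ 1) (F := fun s => F s - M s)
    (by positivity) (lt_min hρ h1a) ?_
    (differentiableOn_zetaDiff ha hab hφ.continuous hc) ?_ hc0 ?_ hb
  · intro s hs
    have hs1 := hs.1
    refine (hF s ?_).sub (hM s ?_)
    · change -ρ < s.re
      linarith [min_le_left ρ 1]
    · change -1 < s.re
      linarith [min_le_right ρ 1]
  · intro s hs
    rw [hFz s hs.1, hM' s hs.1, zeta_fC_eq a b hφ.continuous hc hs.1]
    ring
  · intro n hn
    have e1 : -1 - 1 / (2 * a : ℝ) < -1 := by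
      have : 0 < 1 / (2 * a : ℝ) := by positivity
      linarith
    have e2 : -2 < -1 - 1 / (2 * a : ℝ) := by
      have : 1 / (2 * a : ℝ) < 1 := by rw [div_lt_one (by positivity)]; linarith
      linarith
    rw [hn] at e1 e2
    have e1' : n < -1 := by exact_mod_cast e1
    have e2' : -2 < n := by exact_mod_cast e2
    omega

lemma m0_fC {a b : ℕ} (ha : 2 ≤ a) (hab : a < b) {V : Set (ℝ × ℝ)} (hV : IsOpen V)
    (h0 : (0 : ℝ × ℝ) ∈ V) : m0 V (fC a b) = 1 / (a : ℝ≥0∞) := by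
  have ha0 : (0 : ℝ) < a := by positivity
  rw [m0_eq (σ := 1 / a) (by positivity)
    (fun φ hφ => hasMeromorphicContinuation_fC ha hab hφ.1 hφ.2.1), ENNReal.ofReal_div_of_pos ha0]
  · simp
  · obtain ⟨φ, hφ, r, hr, _, hn, h1, hφ1, _⟩ := exists_bump hV h0
    exact ⟨φ, hφ, fun ρ hρ =>
      not_hasMeromorphicContinuation_fC ha hab hφ.1 hφ.2.1 hn h1 hr hφ1 hρ⟩

/-! ### Case (D): holomorphy up to `-1/b` and growth at `-1/b` -/

lemma expNegInvGlue_le_one (t : ℝ) : expNegInvGlue t ≤ 1 := by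
  unfold expNegInvGlue
  split_ifs with h
  · exact zero_le_one
  · exact Real.exp_le_one_iff.2 (by
      have : 0 < t⁻¹ := inv_pos.2 (not_le.1 h)
      linarith)

lemma continuous_fD (a b : ℕ) : Continuous (fD a b) := by
  have := continuous_psi 1
  have := contDiff_expNegInvGlue.continuous
  unfold fD
  fun_prop

/-- The function `|x| ^ (a s) |y| ^ ((b - 2) s) (y ^ 2 + psi x) ^ s`. -/
def unshearedPower (a b : ℕ) (s : ℝ) (z : ℝ × ℝ) : ℝ :=
  |z.1| ^ (a * s) * (|z.2| ^ ((b - 2 : ℕ) * s) * (z.2 ^ 2 + psi 1 z.1) ^ s)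

lemma unshearedPower_nonneg (a b : ℕ) (s : ℝ) (z : ℝ × ℝ) : 0 ≤ unshearedPower a b s z := by
  have := psi_nonneg 1 z.1
  unfold unshearedPower
  positivity

lemma measurable_unshearedPower (a b : ℕ) (s : ℝ) : Measurable (unshearedPower a b s) := by
  have := (continuous_psi 1).measurable
  unfold unshearedPower
  fun_prop

/-- The shift `(x, y) ↦ (x + expNegInvGlue y, y)`. -/
def shear (z : ℝ × ℝ) : ℝ × ℝ := (z.1 + expNegInvGlue z.2, z.2)

lemma measurable_shear : Measurable shear := by
  have := contDiff_expNegInvGlue.continuous.measurable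
  unfold shear
  fun_prop

lemma abs_fD_rpow (a b : ℕ) (s : ℝ) (z : ℝ × ℝ) :
    |fD a b z| ^ s = |z.1| ^ ((a - 1 : ℕ) * s) * |z.1 + expNegInvGlue z.2| ^ s *
      (|z.2| ^ ((b - 2 : ℕ) * s) * (z.2 ^ 2 + psi 1 z.1) ^ s) := by
  have h := psi_nonneg 1 z.1
  rw [fD, abs_mul, abs_mul, abs_mul, abs_pow, abs_pow,
    abs_of_nonneg (by positivity : 0 ≤ z.2 ^ 2 + psi 1 z.1),
    Real.mul_rpow (by positivity) (by positivity), Real.mul_rpow (by positivity) (by positivity),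
    Real.mul_rpow (by positivity) (by positivity),
    ← Real.rpow_natCast_mul (abs_nonneg z.1), ← Real.rpow_natCast_mul (abs_nonneg z.2)]

lemma abs_rpow_split {a : ℕ} (ha : 1 ≤ a) {t : ℝ} (ht : t ≠ 0) (s : ℝ) :
    |t| ^ (a * s) = |t| ^ ((a - 1 : ℕ) * s) * |t| ^ s := by
  rw [← Real.rpow_add (abs_pos.2 ht), Nat.cast_sub ha]
  congr 1
  push_cast
  ring

/-- For negative `s`, replacing both `|x|` and `|x + e(y)|` by the smaller of the two increases the
power; `psi_mono` does the same inside `y² + ψ`. The two summands correspond to which one is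
smaller. -/
lemma abs_fD_rpow_le {a b : ℕ} (ha : 1 ≤ a) {s : ℝ} (hs : s < 0) {z : ℝ × ℝ} (hx : z.1 ≠ 0) :
    |fD a b z| ^ s ≤ unshearedPower a b s z + unshearedPower a b s (shear z) := by
  have h1 := unshearedPower_nonneg a b s z
  have h2 := unshearedPower_nonneg a b s (shear z)
  set t := z.1 + expNegInvGlue z.2 with ht
  rw [abs_fD_rpow, ← ht]
  by_cases ht0 : t = 0
  · rw [ht0, abs_zero, Real.zero_rpow hs.ne, mul_zero, zero_mul]
    linarith
  have hX : 0 < |z.1| := abs_pos.2 hx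
  have hT : 0 < |t| := abs_pos.2 ht0
  have hψx := psi_pos 1 hx
  have hψt := psi_pos 1 ht0
  rcases le_total |z.1| |t| with h | h
  · have e : |t| ^ s ≤ |z.1| ^ s := Real.rpow_le_rpow_of_nonpos hX h hs.le
    have : |z.1| ^ ((a - 1 : ℕ) * s) * |t| ^ s *
        (|z.2| ^ ((b - 2 : ℕ) * s) * (z.2 ^ 2 + psi 1 z.1) ^ s) ≤ unshearedPower a b s z := by
      rw [unshearedPower, abs_rpow_split ha hx]
      gcongr
    linarith
  · have e1 : |z.1| ^ ((a - 1 : ℕ) * s) ≤ |t| ^ ((a - 1 : ℕ) * s) :=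
      Real.rpow_le_rpow_of_nonpos hT h (mul_nonpos_of_nonneg_of_nonpos (Nat.cast_nonneg _) hs.le)
    have e2 : (z.2 ^ 2 + psi 1 z.1) ^ s ≤ (z.2 ^ 2 + psi 1 t) ^ s :=
      Real.rpow_le_rpow_of_nonpos (by positivity) (by linarith [psi_mono 1 h]) hs.le
    have : |z.1| ^ ((a - 1 : ℕ) * s) * |t| ^ s *
        (|z.2| ^ ((b - 2 : ℕ) * s) * (z.2 ^ 2 + psi 1 z.1) ^ s) ≤
          unshearedPower a b s (shear z) := by
      rw [unshearedPower, shear, ← ht, abs_rpow_split ha ht0]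
      gcongr
    linarith

lemma unshearedPower_le {a b : ℕ} (hb : 2 ≤ b) {s : ℝ} (hs : s < 0) {z : ℝ × ℝ} (hy : z.2 ≠ 0) :
    unshearedPower a b s z ≤ |z.1| ^ (a * s) * |z.2| ^ (b * s) := by
  have hY : 0 < |z.2| := abs_pos.2 hy
  have e1 : (z.2 ^ 2 + psi 1 z.1) ^ s ≤ (z.2 ^ 2) ^ s :=
    Real.rpow_le_rpow_of_nonpos (by positivity) (by linarith [psi_nonneg 1 z.1]) hs.le
  have e2 : |z.2| ^ (b * s) = |z.2| ^ ((b - 2 : ℕ) * s) * (z.2 ^ 2) ^ s := by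
    rw [← sq_abs, ← Real.rpow_natCast_mul hY.le, ← Real.rpow_add hY, Nat.cast_sub hb]
    congr 1
    push_cast
    ring
  rw [unshearedPower, e2]
  gcongr

/-- For fixed `y` the shear is a translation in `x` by an amount in `[0, 1]`. -/
lemma lintegral_shear_le {R : ℝ} {G : ℝ × ℝ → ℝ≥0∞} (hG : Measurable G) :
    ∫⁻ z in Icc (-R) R ×ˢ Icc (-R) R, G (shear z) ≤
      ∫⁻ z in Icc (-(R + 1)) (R + 1) ×ˢ Icc (-R) R, G z := by
  have hGs : Measurable fun z => G (shear z) := hG.comp measurable_shear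
  rw [Measure.volume_eq_prod, ← Measure.prod_restrict, ← Measure.prod_restrict,
    lintegral_prod_symm' _ hGs, lintegral_prod_symm' _ hG]
  refine lintegral_mono fun y => ?_
  simp only [shear]
  set c := expNegInvGlue y with hc
  have hc0 : 0 ≤ c := expNegInvGlue.nonneg y
  have hc1 : c ≤ 1 := expNegInvGlue_le_one y
  rw [← lintegral_indicator measurableSet_Icc, ← lintegral_indicator measurableSet_Icc,
    ← lintegral_add_right_eq_self ((Icc (-(R + 1)) (R + 1)).indicator fun x => G (x, y)) c]
  refine lintegral_mono fun x => ?_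
  by_cases hx : x ∈ Icc (-R) R
  · rw [indicator_of_mem hx, indicator_of_mem]
    exact ⟨by linarith [hx.1], by linarith [hx.2]⟩
  · rw [indicator_of_notMem hx]
    exact zero_le

lemma locallyIntegrable_fD {a b : ℕ} (ha : 1 ≤ a) (hab : a < b) {σ : ℝ}
    (hσ : -(1 / (b : ℝ)) < σ) (hσ0 : σ < 0) : LocallyIntegrable fun z => |fD a b z| ^ σ := by
  have hb0 : (0 : ℝ) < b := by
    have : 0 < b := by omega
    positivity
  have ha0 : (0 : ℝ) < a := by positivity
  have hab' : (a : ℝ) < b := by exact_mod_cast hab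
  have hbσ : -1 < b * σ := by
    have := mul_lt_mul_of_pos_left hσ hb0
    rwa [mul_neg, mul_one_div_cancel hb0.ne'] at this
  have haσ : -1 < a * σ := by nlinarith
  have hfm := (continuous_fD a b).measurable
  refine locallyIntegrable_of_box (by fun_prop) (fun z => by positivity) fun R hR => ?_
  set m : ℝ × ℝ → ℝ≥0∞ := fun z => ENNReal.ofReal (|z.1| ^ (a * σ) * |z.2| ^ (b * σ)) with hm
  have hmm : Measurable m := by fun_prop
  calc ∫⁻ z in Icc (-R) R ×ˢ Icc (-R) R, ENNReal.ofReal (|fD a b z| ^ σ)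
      ≤ ∫⁻ z in Icc (-R) R ×ˢ Icc (-R) R, (m z + m (shear z)) := by
        refine lintegral_mono_ae (ae_restrict_of_ae ?_)
        filter_upwards [ae_fst_ne_zero, ae_snd_ne_zero] with z hx hy
        rw [hm, ← ENNReal.ofReal_add (by positivity) (by positivity)]
        refine ENNReal.ofReal_le_ofReal ((abs_fD_rpow_le ha hσ0 hx).trans ?_)
        exact add_le_add (unshearedPower_le (by omega) hσ0 hy)
          (unshearedPower_le (z := shear z) (by omega) hσ0 hy)
    _ = (∫⁻ z in Icc (-R) R ×ˢ Icc (-R) R, m z) +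
          ∫⁻ z in Icc (-R) R ×ˢ Icc (-R) R, m (shear z) := lintegral_add_left hmm _
    _ < ⊤ := by
        refine ENNReal.add_lt_top.2 ⟨lintegral_box_monomial_lt_top haσ hbσ hR hR, ?_⟩
        exact (lintegral_shear_le hmm).trans_lt
          (lintegral_box_monomial_lt_top haσ hbσ (by linarith) hR)

lemma differentiableOn_zeta_fD {a b : ℕ} (ha : 1 ≤ a) (hab : a < b) {φ : ℝ × ℝ → ℝ}
    (hφ : Continuous φ) (hc : HasCompactSupport φ) :
    DifferentiableOn ℂ (fun s => ∫ z, absCpow (fD a b z) s * (φ z : ℂ))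
      (strip (-(1 / (b : ℝ))) 1) := by
  have : 0 < b := by omega
  exact differentiableOn_of_locallyIntegrable (continuous_fD a b) hφ hc (by positivity)
    fun σ h1 h2 => locallyIntegrable_fD ha hab h1 h2

lemma hasMeromorphicContinuation_fD {a b : ℕ} (ha : 1 ≤ a) (hab : a < b) {φ : ℝ × ℝ → ℝ}
    (hφ : Continuous φ) (hc : HasCompactSupport φ) :
    HasMeromorphicContinuation (fD a b) φ (1 / b) :=
  hasMeromorphicContinuation_of_strip (continuous_fD a b) hφ hc
    (fun _ hs => ((differentiableOn_zeta_fD ha hab hφ hc).analyticAt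
      ((isOpen_strip _ _).mem_nhds hs)).meromorphicAt) fun _ hs => (zeta_eq hs.1).symm

/-- Split at `|y| = ε`: below, `y²` is dropped from the sum; above, `ε²` is dropped and `|y|^(d-1)`
remains. -/
lemma lintegral_abs_rpow_mul_add_sq_le {q s d ε : ℝ} (hq : -1 < q) (hs : s < 0) (hd : 0 < d)
    (hqd : q + 2 * s = d - 1) (hε : 0 < ε) (hε1 : ε ≤ 1) :
    ∫⁻ y in Icc (-1 : ℝ) 1, ENNReal.ofReal (|y| ^ q * (y ^ 2 + ε ^ 2) ^ s) ≤
      ENNReal.ofReal (2 * (1 / (q + 1) + (1 - ε ^ d) / d)) := by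
  have h : ∫⁻ y in Icc (-1 : ℝ) 1, ENNReal.ofReal (|y| ^ q * (y ^ 2 + ε ^ 2) ^ s) =
      ∫⁻ y, (fun u => (Iic 1).indicator
        (fun u => ENNReal.ofReal (u ^ q * (u ^ 2 + ε ^ 2) ^ s)) u) |y| := by
    rw [← lintegral_indicator measurableSet_Icc]
    congr 1
    funext t
    simp only [indicator, mem_Icc, mem_Iic, abs_le, sq_abs]
  have hq1 : 0 < q + 1 := by linarith
  have hεd : ε ^ d ≤ 1 := Real.rpow_le_one hε.le hε1 hd.le
  rw [h, lintegral_comp_abs_eq, setLIntegral_indicator measurableSet_Iic, inter_comm,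
    show Ioi (0 : ℝ) ∩ Iic 1 = Ioc 0 1 from Ioi_inter_Iic, ← Ioc_union_Ioc_eq_Ioc hε.le hε1,
    lintegral_union measurableSet_Ioc (disjoint_left.2 fun t h1 h2 => not_lt.2 h1.2 h2.1)]
  have h1 : ∫⁻ u in Ioc 0 ε, ENNReal.ofReal (u ^ q * (u ^ 2 + ε ^ 2) ^ s) ≤
      ENNReal.ofReal (1 / (q + 1)) := by
    calc _ ≤ ∫⁻ u in Ioc 0 ε, ENNReal.ofReal ((ε ^ 2) ^ s) * ENNReal.ofReal (u ^ q) := by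
          refine setLIntegral_mono' measurableSet_Ioc fun u hu => ?_
          rw [← ENNReal.ofReal_mul (by positivity), mul_comm]
          refine ENNReal.ofReal_le_ofReal (mul_le_mul_of_nonneg_right ?_
            (Real.rpow_nonneg hu.1.le _))
          exact Real.rpow_le_rpow_of_nonpos (by positivity) (by nlinarith [sq_nonneg u]) hs.le
      _ ≤ _ := by
          rw [lintegral_const_mul _ (by fun_prop), lintegral_Ioc_zero_rpow hq hε.le,
            ← ENNReal.ofReal_mul (by positivity)]
          refine ENNReal.ofReal_le_ofReal ?_
          have e : (ε ^ 2) ^ s * ε ^ (q + 1) = ε ^ d := by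
            rw [← Real.rpow_natCast_mul hε.le, ← Real.rpow_add hε]
            congr 1
            push_cast
            linarith
          rw [mul_div_assoc', e]
          gcongr
  have h2 : ∫⁻ u in Ioc ε 1, ENNReal.ofReal (u ^ q * (u ^ 2 + ε ^ 2) ^ s) ≤
      ENNReal.ofReal ((1 - ε ^ d) / d) := by
    have e := lintegral_Ioc_rpow_sub_one hd.ne' hε hε1
    rw [Real.one_rpow] at e
    rw [← e]
    refine setLIntegral_mono' measurableSet_Ioc fun u hu => ENNReal.ofReal_le_ofReal ?_
    have hu0 : 0 < u := hε.trans hu.1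
    have e2 : u ^ (d - 1) = u ^ q * (u ^ 2) ^ s := by
      rw [← Real.rpow_natCast_mul hu0.le, ← Real.rpow_add hu0]
      congr 1
      push_cast
      linarith
    rw [e2]
    refine mul_le_mul_of_nonneg_left ?_ (by positivity)
    exact Real.rpow_le_rpow_of_nonpos (by positivity) (by nlinarith [sq_nonneg ε]) hs.le
  have hd' : 0 ≤ (1 - ε ^ d) / d := div_nonneg (by linarith) hd.le
  calc _ ≤ 2 * (ENNReal.ofReal (1 / (q + 1)) + ENNReal.ofReal ((1 - ε ^ d) / d)) := by gcongr
    _ = _ := by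
        rw [← ENNReal.ofReal_add (by positivity) hd',
          show (2 : ℝ≥0∞) = ENNReal.ofReal 2 by simp, ← ENNReal.ofReal_mul (by norm_num)]

lemma lintegral_unshearedPower_snd_le {b : ℕ} (hb : 2 ≤ b) {x s d η : ℝ} (hx : x ≠ 0)
    (hx2 : |x| ≤ 2) (hd : 0 < d) (hd1 : d < 1) (hs : s = 1 / b * (d - 1)) (hηd : η ^ 2 = d) :
    ∫⁻ y in Icc (-1 : ℝ) 1,
      ENNReal.ofReal (|y| ^ ((b - 2 : ℕ) * s) * (y ^ 2 + psi 1 x) ^ s) ≤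
      ENNReal.ofReal (2 * (2 * b + 1) * d⁻¹ * min 1 ((η / |x|) ^ (2 : ℝ))) := by
  have hb0 : (0 : ℝ) < b := by positivity
  have hbs : b * s = d - 1 := by rw [hs]; field_simp
  have hs0 : s < 0 := by
    rw [hs]; exact mul_neg_of_pos_of_neg (by positivity) (by linarith)
  have hcast : ((b - 2 : ℕ) : ℝ) = b - 2 := by push_cast [Nat.cast_sub hb]; ring
  have hq1 : 2 / b ≤ (b - 2 : ℕ) * s + 1 := by
    have h3 : (b - 2 : ℕ) * s + 1 = 2 / b + (b - 2 : ℕ) / b * d := by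
      rw [hcast, hs]; field_simp; ring
    rw [h3]
    have : 0 ≤ ((b - 2 : ℕ) : ℝ) / b * d := by positivity
    linarith
  have h2b : 0 < 2 / (b : ℝ) := by positivity
  set ε := √(psi 1 x) with hε
  have hε0 : 0 < ε := Real.sqrt_pos.2 (psi_pos 1 hx)
  have hε2 : psi 1 x = ε ^ 2 := (Real.sq_sqrt (psi_nonneg 1 x)).symm
  have hε1 : ε ≤ 1 := by
    refine Real.sqrt_le_iff.2 ⟨zero_le_one, ?_⟩
    rw [one_pow]
    exact expNegInvGlue_le_one _
  rw [hε2]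
  refine (lintegral_abs_rpow_mul_add_sq_le (by linarith) hs0 hd (by rw [hcast]; linarith)
    hε0 hε1).trans (ENNReal.ofReal_le_ofReal ?_)
  have hX : 0 < |x| := abs_pos.2 hx
  have hηx : (η / |x|) ^ (2 : ℝ) = d / x ^ 2 := by
    rw [Real.rpow_two, div_pow, hηd, sq_abs]
  have hx2' : 0 < x ^ 2 := by positivity
  have hx4 : x ^ 2 ≤ 4 := by rw [← sq_abs]; nlinarith
  rw [hηx]
  have hmin : d⁻¹ * min 1 (d / x ^ 2) = min d⁻¹ (1 / x ^ 2) := by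
    rw [mul_min_of_nonneg _ _ (by positivity), mul_one]
    congr 1
    field_simp
  have e1 : 1 / ((b - 2 : ℕ) * s + 1) ≤ b / 2 := by
    rw [show (b : ℝ) / 2 = 1 / (2 / b) by rw [one_div_div]]
    exact one_div_le_one_div_of_le h2b hq1
  -- This is where `|x| ≤ 2` enters: the bounded contribution of `|y| ≤ ε` is absorbed into the main
  -- term.
  have e2 : 1 / 4 ≤ min d⁻¹ (1 / x ^ 2) := by
    refine le_min ?_ (one_div_le_one_div_of_le hx2' hx4)
    have : 1 ≤ d⁻¹ := (one_le_inv₀ hd).2 hd1.le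
    linarith
  -- Here `ε ^ d = exp(-d/(2x²))`, and `1 - exp(-t) ≤ t` gives the branch `1/x²`.
  have e3 : (1 - ε ^ d) / d ≤ min d⁻¹ (1 / x ^ 2) := by
    have hεd : ε ^ d = Real.exp (-(d / 2 / x ^ 2)) := by
      rw [hε, Real.sqrt_eq_rpow, ← Real.rpow_mul (psi_nonneg _ _), psi_rpow 1 hx]
      congr 3
      ring
    refine le_min ?_ ?_
    · rw [div_eq_mul_inv]
      exact mul_le_of_le_one_left (by positivity) (by linarith [Real.rpow_nonneg hε0.le d])
    · rw [hεd, div_le_iff₀ hd]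
      have := Real.add_one_le_exp (-(d / 2 / x ^ 2))
      have h5 : d / 2 / x ^ 2 = 1 / x ^ 2 * d / 2 := by ring
      have h6 : 0 < 1 / x ^ 2 * d := by positivity
      linarith
  have hb2 : (0 : ℝ) ≤ 2 * b := by positivity
  calc 2 * (1 / ((b - 2 : ℕ) * s + 1) + (1 - ε ^ d) / d)
      ≤ 2 * (2 * b * min d⁻¹ (1 / x ^ 2) + min d⁻¹ (1 / x ^ 2)) := by
        have := mul_le_mul_of_nonneg_left e2 hb2
        linarith
    _ = 2 * (2 * b + 1) * (d⁻¹ * min 1 (d / x ^ 2)) := by rw [hmin]; ring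
    _ = _ := by ring

lemma lintegral_fD_le {a b : ℕ} (ha : 1 ≤ a) (hab : a < b) {φ : ℝ × ℝ → ℝ}
    (h1 : ∀ z, φ z ≤ 1) (hsupp : ∀ x y : ℝ, φ (x, y) ≠ 0 → |x| ≤ 1 ∧ |y| ≤ 1)
    {d η s : ℝ} (hd : 0 < d) (hd1 : d < 1) (hs : s = 1 / b * (d - 1)) (hη : 0 < η)
    (hηd : η ^ 2 = d) :
    ∫⁻ z, ENNReal.ofReal (|fD a b z| ^ s * φ z) ≤
      ENNReal.ofReal (8 * (2 * b + 1) * d⁻¹ * η ^ (a * s + 1) * (1 / (1 - a / b) + 1)) := by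
  have hb2 : 2 ≤ b := by omega
  have hb0 : (0 : ℝ) < b := by positivity
  have ha0 : (0 : ℝ) < a := by positivity
  have hab' : (a : ℝ) < b := by exact_mod_cast hab
  have hs0 : s < 0 := by
    rw [hs]; exact mul_neg_of_pos_of_neg (by positivity) (by linarith)
  have has0 : a * s < 0 := mul_neg_of_pos_of_neg ha0 hs0
  have hγ : 0 < 1 - (a : ℝ) / b := by
    rw [sub_pos, div_lt_one hb0]; exact hab'
  have has : 1 - (a : ℝ) / b ≤ a * s + 1 := by
    have e : a * s + 1 = 1 - a / b + a / b * d := by rw [hs]; ring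
    rw [e]
    have : 0 < (a : ℝ) / b * d := by positivity
    linarith
  set G : ℝ × ℝ → ℝ≥0∞ := fun z => ENNReal.ofReal (unshearedPower a b s z) with hG
  have hGm : Measurable G := (measurable_unshearedPower a b s).ennreal_ofReal
  have hψm := (continuous_psi 1).measurable
  have step1 : ∫⁻ z, ENNReal.ofReal (|fD a b z| ^ s * φ z) ≤
      ∫⁻ z in Icc (-1 : ℝ) 1 ×ˢ Icc (-1 : ℝ) 1, (G z + G (shear z)) := by
    rw [← lintegral_indicator (measurableSet_Icc.prod measurableSet_Icc)]
    refine lintegral_mono_ae ?_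
    filter_upwards [ae_fst_ne_zero] with z hx
    by_cases hz : φ z = 0
    · simp [hz]
    · obtain ⟨k1, k2⟩ := hsupp z.1 z.2 hz
      rw [indicator_of_mem (show z ∈ Icc (-1 : ℝ) 1 ×ˢ Icc (-1 : ℝ) 1 from
        ⟨abs_le.1 k1, abs_le.1 k2⟩), hG, ← ENNReal.ofReal_add (unshearedPower_nonneg _ _ _ _)
        (unshearedPower_nonneg _ _ _ _)]
      refine ENNReal.ofReal_le_ofReal ((mul_le_of_le_one_right (by positivity) (h1 z)).trans ?_)
      exact abs_fD_rpow_le ha hs0 hx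
  have step2 : ∫⁻ z in Icc (-1 : ℝ) 1 ×ˢ Icc (-1 : ℝ) 1, (G z + G (shear z)) ≤
      2 * ∫⁻ z in Icc (-2 : ℝ) 2 ×ˢ Icc (-1 : ℝ) 1, G z := by
    rw [lintegral_add_left hGm, two_mul]
    have e := lintegral_shear_le (R := 1) hGm
    rw [one_add_one_eq_two] at e
    refine add_le_add (lintegral_mono_set (prod_mono ?_ subset_rfl)) e
    exact Icc_subset_Icc (by norm_num) (by norm_num)
  have step3 : ∫⁻ z in Icc (-2 : ℝ) 2 ×ˢ Icc (-1 : ℝ) 1, G z ≤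
      ENNReal.ofReal (2 * (2 * b + 1) * d⁻¹) * ENNReal.ofReal (2 * η ^ (a * s + 1) *
          (1 / (a * s + 1) + 1 / (2 - a * s - 1))) := by
    rw [Measure.volume_eq_prod, ← Measure.prod_restrict, lintegral_prod _ hGm.aemeasurable]
    calc _ ≤ ∫⁻ x in Icc (-2 : ℝ) 2, ENNReal.ofReal (2 * (2 * b + 1) * d⁻¹) *
          ENNReal.ofReal (|x| ^ (a * s) * min 1 ((η / |x|) ^ (2 : ℝ))) := by
          refine lintegral_mono_ae ?_
          filter_upwards [ae_restrict_mem measurableSet_Icc,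
            ae_restrict_of_ae (Measure.ae_ne volume (0 : ℝ))] with x hx hx0
          have e : ∀ y : ℝ, G (x, y) = ENNReal.ofReal (|x| ^ (a * s)) *
              ENNReal.ofReal (|y| ^ ((b - 2 : ℕ) * s) * (y ^ 2 + psi 1 x) ^ s) := fun y => by
            rw [hG, ← ENNReal.ofReal_mul (by positivity)]; rfl
          simp only [e]
          rw [lintegral_const_mul _ (by fun_prop)]
          calc _ ≤ ENNReal.ofReal (|x| ^ (a * s)) *
                ENNReal.ofReal (2 * (2 * b + 1) * d⁻¹ * min 1 ((η / |x|) ^ (2 : ℝ))) := by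
                gcongr
                exact lintegral_unshearedPower_snd_le hb2 hx0 (abs_le.2 hx) hd hd1 hs hηd
            _ = _ := by
                rw [← ENNReal.ofReal_mul (by positivity), ← ENNReal.ofReal_mul (by positivity)]
                congr 1
                ring
      _ ≤ ∫⁻ x, ENNReal.ofReal (2 * (2 * b + 1) * d⁻¹) *
          ENNReal.ofReal (|x| ^ (a * s) * min 1 ((η / |x|) ^ (2 : ℝ))) :=
          setLIntegral_le_lintegral _ _
      _ ≤ _ := by
          rw [lintegral_const_mul _ (by fun_prop)]
          gcongr
          exact lintegral_rpow_mul_min_le (by linarith) (by linarith) hη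
  have hp1 : 0 < a * s + 1 := by linarith
  have hp2 : 0 < 2 - a * s - 1 := by linarith
  calc _ ≤ 2 * (ENNReal.ofReal (2 * (2 * b + 1) * d⁻¹) * ENNReal.ofReal (2 * η ^ (a * s + 1) *
          (1 / (a * s + 1) + 1 / (2 - a * s - 1)))) :=
        step1.trans (step2.trans (by gcongr))
    _ ≤ _ := by
        rw [← ENNReal.ofReal_mul (by positivity),
          show (2 : ℝ≥0∞) = ENNReal.ofReal 2 by simp, ← ENNReal.ofReal_mul (by norm_num)]
        refine ENNReal.ofReal_le_ofReal ?_
        have e1 : 1 / (a * s + 1) ≤ 1 / (1 - a / b) := one_div_le_one_div_of_le hγ has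
        have e2 : 1 / (2 - a * s - 1) ≤ 1 := by
          rw [div_le_one hp2]; linarith
        calc 2 * (2 * (2 * b + 1) * d⁻¹ * (2 * η ^ (a * s + 1) *
              (1 / (a * s + 1) + 1 / (2 - a * s - 1))))
            = 8 * (2 * b + 1) * d⁻¹ * η ^ (a * s + 1) *
              (1 / (a * s + 1) + 1 / (2 - a * s - 1)) := by ring
          _ ≤ _ := by gcongr

/-- The box has `y` negative, where the shear is trivial. For `x ≤ 2η`, `ψ(x) ≤ ψ(2η) = exp(-1/(4d))
= e²`, so `|y| > e` makes `y²` dominate `ψ(x)`. As `e ^ d = exp(-1/8)` stays away from `1`, the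
integral of `|y|^(d-1)` has order `d⁻¹`. -/
lemma le_lintegral_fD {a b : ℕ} (ha : 1 ≤ a) (hab : a < b) {φ : ℝ × ℝ → ℝ} {r : ℝ}
    (h1 : ∀ x y : ℝ, |x| ≤ r → |y| ≤ r → φ (x, y) = 1)
    {d η s c : ℝ} (hd : 0 < d) (hd1 : d < 1) (hs : s = 1 / b * (d - 1)) (hη : 0 < η)
    (hηd : η ^ 2 = d) (hηr : 2 * η ≤ r) (hdr : Real.exp (-(1 / (8 * d))) ≤ r)
    (hc : c ≤ r ^ d - Real.exp (-(1 / 8))) :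
    ENNReal.ofReal (1 / 4 * c * d⁻¹ * η ^ (a * s + 1)) ≤
      ∫⁻ z, ENNReal.ofReal (|fD a b z| ^ s * φ z) := by
  have hb2 : 2 ≤ b := by omega
  have hb0 : (0 : ℝ) < b := by positivity
  have ha0 : (0 : ℝ) < a := by positivity
  have hab' : (a : ℝ) < b := by exact_mod_cast hab
  have hbs : b * s = d - 1 := by rw [hs]; field_simp
  have hs0 : s < 0 := by
    rw [hs]; exact mul_neg_of_pos_of_neg (by positivity) (by linarith)
  have has0 : a * s < 0 := mul_neg_of_pos_of_neg ha0 hs0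
  have has1 : -1 ≤ a * s := by nlinarith
  have hs1 : -1 ≤ s := by
    have : (1 : ℝ) ≤ a := by exact_mod_cast ha
    nlinarith
  set e := Real.exp (-(1 / (8 * d))) with he
  have he0 : 0 < e := Real.exp_pos _
  -- The coordinates are swapped because `le_lintegral_box` integrates a power of the first
  -- variable, here `y`.
  rw [Measure.volume_eq_prod, ← lintegral_prod_swap, ← Measure.volume_eq_prod]
  have hbox := le_lintegral_box
    (g := fun z : ℝ × ℝ => ENNReal.ofReal (|fD a b z.swap| ^ s * φ z.swap))
    (S := Neg.neg ⁻¹' (Ioc e r)) (T := Icc η (2 * η)) (measurableSet_Ioc.preimage measurable_neg)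
    measurableSet_Icc
    (u := fun y => ENNReal.ofReal (1 / 4 * η ^ (a * s)) * ENNReal.ofReal (|y| ^ (d - 1)))
    (by fun_prop) ?_
  · refine le_trans ?_ hbox
    have hneg : ∫⁻ y in Neg.neg ⁻¹' (Ioc e r), ENNReal.ofReal (|y| ^ (d - 1)) =
        ENNReal.ofReal ((r ^ d - e ^ d) / d) := by
      have k1 := setLIntegral_neg (fun y => ENNReal.ofReal (|y| ^ (d - 1))) (Ioc e r)
      simp only [abs_neg] at k1
      rw [k1, ← lintegral_Ioc_rpow_sub_one hd.ne' he0 hdr]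
      refine setLIntegral_congr_fun measurableSet_Ioc fun t ht => ?_
      simp only [abs_of_pos (he0.trans ht.1)]
    have hed : e ^ d = Real.exp (-(1 / 8)) := by
      rw [he, ← Real.exp_mul]; congr 1; field_simp
    rw [lintegral_const_mul _ (by fun_prop), hneg, hed, Real.volume_Icc,
      ← ENNReal.ofReal_mul (by positivity), ← ENNReal.ofReal_mul' (by linarith)]
    refine ENNReal.ofReal_le_ofReal ?_
    rw [Real.rpow_add_one hη.ne', div_eq_mul_inv]
    calc 1 / 4 * c * d⁻¹ * (η ^ (a * s) * η) = 1 / 4 * d⁻¹ * (η ^ (a * s) * η) * c := by ring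
      _ ≤ 1 / 4 * d⁻¹ * (η ^ (a * s) * η) * (r ^ d - Real.exp (-(1 / 8))) := by gcongr
      _ = _ := by ring
  · intro y hy x hx
    have hyn : e < -y ∧ -y ≤ r := hy
    rw [← ENNReal.ofReal_mul (by positivity)]
    refine ENNReal.ofReal_le_ofReal ?_
    have hx0 : 0 < x := hη.trans_le hx.1
    have hy0 : y < 0 := by linarith
    have hY : 0 < |y| := abs_pos.2 hy0.ne
    simp only [Prod.swap_prod_mk]
    rw [h1 x y (by rw [abs_of_pos hx0]; linarith [hx.2]) (by rw [abs_of_neg hy0]; exact hyn.2),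
      mul_one, abs_fD_rpow]
    simp only
    rw [expNegInvGlue.zero_of_nonpos hy0.le, add_zero, ← abs_rpow_split ha hx0.ne', abs_of_pos hx0]
    have hψ : psi 1 x ≤ y ^ 2 := by
      have k1 : psi 1 x ≤ psi 1 (2 * η) := by
        refine psi_mono 1 ?_
        rw [abs_of_pos hx0, abs_of_pos (by positivity)]
        exact hx.2
      have k2 : psi 1 (2 * η) = e ^ 2 := by
        rw [psi_of_ne_zero 1 (by positivity), he, ← Real.exp_nat_mul]
        congr 1
        rw [mul_one, mul_pow, hηd]
        push_cast
        field_simp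
        norm_num
      have k3 : e ^ 2 ≤ y ^ 2 := by
        have := pow_le_pow_left₀ he0.le hyn.1.le 2
        rwa [neg_sq] at this
      linarith
    have hψ0 := psi_pos 1 hx0.ne'
    have e1 : 1 / 2 * η ^ (a * s) ≤ x ^ (a * s) := by
      have k1 : (2 * η) ^ (a * s) ≤ x ^ (a * s) := Real.rpow_le_rpow_of_nonpos hx0 hx.2 has0.le
      have k2 : (2 : ℝ) ^ (-1 : ℝ) ≤ 2 ^ (a * s) :=
        Real.rpow_le_rpow_of_exponent_le (by norm_num) has1
      rw [Real.mul_rpow (by norm_num) hη.le] at k1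
      rw [Real.rpow_neg_one] at k2
      refine le_trans ?_ k1
      rw [one_div]
      gcongr
    have e2 : 1 / 2 * |y| ^ (d - 1) ≤ |y| ^ ((b - 2 : ℕ) * s) * (y ^ 2 + psi 1 x) ^ s := by
      have k1 : (2 * y ^ 2) ^ s ≤ (y ^ 2 + psi 1 x) ^ s :=
        Real.rpow_le_rpow_of_nonpos (by positivity) (by linarith) hs0.le
      have k2 : (2 : ℝ) ^ (-1 : ℝ) ≤ 2 ^ s := Real.rpow_le_rpow_of_exponent_le (by norm_num) hs1
      have k3 : |y| ^ (d - 1) = |y| ^ ((b - 2 : ℕ) * s) * (y ^ 2) ^ s := by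
        rw [← hbs, ← sq_abs, ← Real.rpow_natCast_mul hY.le, ← Real.rpow_add hY, Nat.cast_sub hb2]
        congr 1
        push_cast
        ring
      rw [Real.mul_rpow (by norm_num) (by positivity)] at k1
      rw [Real.rpow_neg_one] at k2
      rw [k3]
      have k4 : 1 / 2 * (y ^ 2) ^ s ≤ (y ^ 2 + psi 1 x) ^ s := by
        refine le_trans ?_ k1
        rw [one_div]
        gcongr
      calc _ = |y| ^ ((b - 2 : ℕ) * s) * (1 / 2 * (y ^ 2) ^ s) := by ring
        _ ≤ _ := by gcongr
    calc 1 / 4 * η ^ (a * s) * |y| ^ (d - 1) =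
        (1 / 2 * η ^ (a * s)) * (1 / 2 * |y| ^ (d - 1)) := by ring
      _ ≤ _ := by gcongr

lemma zeta_fD_growth {a b : ℕ} (ha : 1 ≤ a) (hab : a < b) {φ : ℝ × ℝ → ℝ} (hφ : Continuous φ)
    (h0 : ∀ z, 0 ≤ φ z) (h1 : ∀ z, φ z ≤ 1)
    (hsupp : ∀ x y : ℝ, φ (x, y) ≠ 0 → |x| ≤ 1 ∧ |y| ≤ 1) {r : ℝ} (hr : 0 < r)
    (hφ1 : ∀ x y : ℝ, |x| ≤ r → |y| ≤ r → φ (x, y) = 1) :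
    ∃ c C : ℝ, 0 < c ∧ ∀ᶠ d : ℝ in 𝓝[>] 0,
      c * d ^ (-1 / 2 - a / (2 * b) : ℝ) ≤
        ‖∫ z, absCpow (fD a b z) ((1 / b * (d - 1) : ℝ) : ℂ) * (φ z : ℂ)‖ ∧
      ‖∫ z, absCpow (fD a b z) ((1 / b * (d - 1) : ℝ) : ℂ) * (φ z : ℂ)‖ ≤
        C * d ^ (-1 / 2 - a / (2 * b) : ℝ) := by
  have hb2 : 2 ≤ b := by omega
  have hb0 : (0 : ℝ) < b := by positivity
  have ha0 : (0 : ℝ) < a := by positivity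
  have hab' : (a : ℝ) < b := by exact_mod_cast hab
  set K : ℝ := a / (2 * b) with hK
  have hK0 : 0 < K := by positivity
  -- Since `r ^ d → 1`, eventually `r ^ d - exp(-1/8)` exceeds half of its limit, which is `c₀`.
  set c₀ : ℝ := (1 - Real.exp (-(1 / 8))) / 2 with hc₀
  have hexp8 : Real.exp (-(1 / 8 : ℝ)) < 1 := (Real.exp_lt_exp.2 (by norm_num)).trans_eq Real.exp_zero
  have hc₀0 : 0 < c₀ := by rw [hc₀]; linarith
  have hγ : 0 < 1 - (a : ℝ) / b := by
    rw [sub_pos, div_lt_one hb0]; exact hab'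
  refine ⟨1 / 4 * c₀ * Real.exp (-K), 8 * (2 * b + 1) * (1 / (1 - a / b) + 1), by positivity, ?_⟩
  have hrd : ∀ᶠ d : ℝ in 𝓝[>] 0, 1 - c₀ < r ^ d := by
    have h := (Real.continuous_const_rpow hr.ne').tendsto 0
    rw [Real.rpow_zero] at h
    exact (h.mono_left nhdsWithin_le_nhds).eventually (lt_mem_nhds (by linarith))
  filter_upwards [eventually_small 1 one_pos, eventually_small (r / 8) (by positivity),
    eventually_rpow_le (e := 1 / (2 : ℕ)) (c := r / 2) (by norm_num) (by positivity), hrd]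
    with d hd hdr hηr hrd
  have hd0 := hd.1
  set η : ℝ := d ^ (1 / (2 : ℕ) : ℝ) with hη
  have hη0 : 0 < η := by positivity
  have hηd : η ^ 2 = d := by
    rw [hη, one_div, Real.rpow_inv_natCast_pow hd0.le (by norm_num)]
  set s : ℝ := 1 / b * (d - 1) with hs
  have hs0 : s < 0 := mul_neg_of_pos_of_neg (by positivity) (by linarith [hd.2])
  have hηpow : d⁻¹ * η ^ (a * s + 1) = d ^ (-1 / 2 - a / (2 * b) : ℝ) * d ^ (K * d) := by
    rw [hη, ← Real.rpow_mul hd0.le, ← Real.rpow_neg_one, ← Real.rpow_add hd0,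
      ← Real.rpow_add hd0]
    congr 1
    rw [hs, hK]
    push_cast
    field_simp
    ring
  have hdα : 0 < d ^ (-1 / 2 - a / (2 * b) : ℝ) := by positivity
  have hdK : Real.exp (-K) ≤ d ^ (K * d) := exp_neg_le_rpow_self_mul hd0 hK0.le
  have hdK1 : d ^ (K * d) ≤ 1 :=
    Real.rpow_le_one hd0.le (by linarith [hd.2]) (by positivity)
  have hexp : Real.exp (-(1 / (8 * d))) ≤ r := by
    have := exp_neg_le_factorial_mul 1 (t := 1 / (8 * d)) (by positivity)
    simp only [Nat.factorial_one, Nat.cast_one, pow_one, one_mul, one_div, inv_inv] at this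
    rw [one_div]
    linarith [hdr.2]
  have hup := lintegral_fD_le ha hab h1 hsupp hd0 hd.2 hs hη0 hηd
  have hlow := le_lintegral_fD (c := c₀) ha hab hφ1 hd0 hd.2 hs hη0 hηd (by linarith) hexp
    (by rw [hc₀] at hrd ⊢; linarith)
  have hm : AEStronglyMeasurable (fun z => |fD a b z| ^ s * φ z) := by
    have := (continuous_fD a b).measurable
    exact Measurable.aestronglyMeasurable (by fun_prop)
  have hn : ∀ᵐ z, 0 ≤ |fD a b z| ^ s * φ z :=
    Eventually.of_forall fun z => mul_nonneg (by positivity) (h0 z)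
  obtain ⟨k1, k2⟩ := abs_integral_bounds hm hn hlow hup (by positivity)
  have hZ : ∫ z, absCpow (fD a b z) (s : ℂ) * (φ z : ℂ) =
      ((∫ z, |fD a b z| ^ s * φ z : ℝ) : ℂ) := by
    rw [← integral_complex_ofReal]
    congr 1
    funext z
    rw [absCpow_ofReal hs0.ne]
    push_cast
    rfl
  rw [hZ]
  constructor
  · refine le_trans ?_ k1
    calc 1 / 4 * c₀ * Real.exp (-K) * d ^ (-1 / 2 - a / (2 * b) : ℝ)
        ≤ 1 / 4 * c₀ * d ^ (K * d) * d ^ (-1 / 2 - a / (2 * b) : ℝ) := by gcongr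
      _ = 1 / 4 * c₀ * (d⁻¹ * η ^ (a * s + 1)) := by rw [hηpow]; ring
      _ = _ := by ring
  · refine k2.trans ?_
    calc 8 * (2 * b + 1) * d⁻¹ * η ^ (a * s + 1) * (1 / (1 - a / b) + 1)
        = 8 * (2 * b + 1) * (1 / (1 - a / b) + 1) * (d⁻¹ * η ^ (a * s + 1)) := by ring
      _ ≤ 8 * (2 * b + 1) * (1 / (1 - a / b) + 1) * (d ^ (-1 / 2 - a / (2 * b) : ℝ) * 1) := by
          rw [hηpow]
          gcongr
      _ = _ := by ring

lemma not_hasMeromorphicContinuation_fD {a b : ℕ} (ha : 1 ≤ a) (hab : a < b) {φ : ℝ × ℝ → ℝ}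
    (hφ : Continuous φ) (hc : HasCompactSupport φ) (h0 : ∀ z, 0 ≤ φ z) (h1 : ∀ z, φ z ≤ 1)
    (hsupp : ∀ x y : ℝ, φ (x, y) ≠ 0 → |x| ≤ 1 ∧ |y| ≤ 1) {r : ℝ} (hr : 0 < r)
    (hφ1 : ∀ x y : ℝ, |x| ≤ r → |y| ≤ r → φ (x, y) = 1) {ρ : ℝ} (hρ : 1 / (b : ℝ) < ρ) :
    ¬ HasMeromorphicContinuation (fD a b) φ ρ := by
  rintro ⟨F, hF, hFz⟩
  have hb2 : 2 ≤ b := by omega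
  have hb0 : (0 : ℝ) < b := by positivity
  have ha0 : (0 : ℝ) < a := by positivity
  have hab' : (a : ℝ) < b := by exact_mod_cast hab
  obtain ⟨c, C, hc0, hb⟩ := zeta_fD_growth ha hab hφ h0 h1 hsupp hr hφ1
  refine no_meromorphic_of_growth (σ := 1 / b) (by positivity) hρ (hF.mono_set fun s hs => hs.1)
    (differentiableOn_zeta_fD ha hab hφ hc) (fun s hs => ?_) hc0 ?_ hb
  · rw [hFz s hs.1, zeta_eq hs.1]
  · intro n hn
    have e0 : 0 < (a : ℝ) / (2 * b) := by positivity
    have e1 : (a : ℝ) / (2 * b) < 1 / 2 := by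
      rw [div_lt_div_iff₀ (by positivity) (by norm_num)]; linarith
    have e2 : (-1 / 2 - a / (2 * b) : ℝ) < 0 := by linarith
    have e3 : -1 < (-1 / 2 - a / (2 * b) : ℝ) := by linarith
    rw [hn] at e2 e3
    have e2' : n < 0 := by exact_mod_cast e2
    have e3' : -1 < n := by exact_mod_cast e3
    omega

lemma m0_fD {a b : ℕ} (ha : 1 ≤ a) (hab : a < b) {V : Set (ℝ × ℝ)} (hV : IsOpen V)
    (h0 : (0 : ℝ × ℝ) ∈ V) : m0 V (fD a b) = 1 / (b : ℝ≥0∞) := by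
  have hb : 0 < b := by omega
  have hb0 : (0 : ℝ) < b := by positivity
  rw [m0_eq (σ := 1 / b) (by positivity)
    (fun φ hφ => hasMeromorphicContinuation_fD ha hab hφ.1.continuous hφ.2.1),
    ENNReal.ofReal_div_of_pos hb0]
  · simp
  · obtain ⟨φ, hφ, r, hr, _, hn, h1, hφ1, hsupp⟩ := exists_bump hV h0
    exact ⟨φ, hφ, fun ρ hρ => not_hasMeromorphicContinuation_fD ha hab hφ.1.continuous hφ.2.1 hn h1
      hsupp hr hφ1 hρ⟩

end LocalZeta

end

theorem mainTheorem5 :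
    (∀ a b : ℕ, 2 ≤ a → a < b →
      ∃ (U : Set (ℝ × ℝ)) (f : ℝ × ℝ → ℝ), IsOpen U ∧ (0 : ℝ × ℝ) ∈ U ∧
        ∀ V : Set (ℝ × ℝ), IsOpen V → (0 : ℝ × ℝ) ∈ V → V ⊆ U →
          LocalZeta.CaseC a b V f ∧ LocalZeta.m0 V f = 1 / (a : ENNReal)) ∧
    (∀ a b : ℕ, 1 ≤ a → a < b →
      ∃ (U : Set (ℝ × ℝ)) (f : ℝ × ℝ → ℝ), IsOpen U ∧ (0 : ℝ × ℝ) ∈ U ∧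
        ∀ V : Set (ℝ × ℝ), IsOpen V → (0 : ℝ × ℝ) ∈ V → V ⊆ U →
          LocalZeta.CaseD a b V f ∧ LocalZeta.m0 V f = 1 / (b : ENNReal)) := by
  refine ⟨fun a b ha hab => ?_, fun a b ha hab => ?_⟩
  · exact ⟨Set.univ, LocalZeta.fC a b, isOpen_univ, Set.mem_univ _, fun V hV h0 _ =>
      ⟨LocalZeta.caseC_fC ha hab hV h0, LocalZeta.m0_fC ha hab hV h0⟩⟩
  · exact ⟨Set.univ, LocalZeta.fD a b, isOpen_univ, Set.mem_univ _, fun V hV h0 _ =>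
      ⟨LocalZeta.caseD_fD ha hab hV h0, LocalZeta.m0_fD ha hab hV h0⟩⟩
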